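/- Conventions. Partitions are identified with Young diagrams; $\eta'$ is the conjugate of $\eta$, $\eta_i$ its $i$-th part (row length), and $|\eta|$ its number of cells. For partitions $\xi,\eta$ of the same size, the Kostka–Foulkes polynomial $K_{\xi\eta}(q)\in\mathbb Z[q]$ is the coefficient in the expansion $s_\xi(x)=\sum_\eta K_{\xi\eta}(q)P_\eta(x;q)$ of the Schur function in Hall–Littlewood functions $P_\eta(x;q)$ (and $K_{\xi\eta}(q)=0$ if $|\xi|\ne|\eta|$). The Kostka number is $K_{\xi\eta}=K_{\xi\eta}(1)$; for a composition $\lambda\in(\mathbb Z_{\ge0})^n$, $K_{\xi\lambda}$ means $K_{\xi\lambda^+}$, where $\lambda^+$ is the partition obtained by sorting the components of $\lambda$ in decreasing order. Put $(q)_m=\prod_{i=1}^m(1-q^i)$ and $$\left[{m\atop k}\right]=\frac{(q)_m}{(q)_k(q)_{m-k}}\ \text{ if } 0\le k\le m,\qquad \left[{m\atop k}\right]=0\ \text{ otherwise.}$$ Proposition. Let $\mu$ be a partition and $\lambda=(\lambda_1,\dots,\lambda_n)\in(\mathbb Z_{\ge 0})^n$ a composition such that $|\lambda|=\lambda_1+\cdots+\lambda_n=|\mu|$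 and $\mu_1\le n-1$. Then $$\sum_{\eta:\ |\eta|=|\mu|,\ \eta_1\le n}K_{\eta'\lambda}\,K_{\eta\mu}(q)=\sum_{\{\nu\}}\ \prod_{\substack{1\le a\le n-1\\ 1\le i\le\mu_1}}\left[{\nu^{(a+1)}_i-\nu^{(a+1)}_{i+1}\atop \nu^{(a)}_i-\nu^{(a+1)}_{i+1}}\right],$$ where the sum on the right runs over all sequences of Young diagrams $\nu^{(1)},\dots,\nu^{(n-1)}$ such that $$\emptyset=:\nu^{(0)}\subseteq\nu^{(1)}\subseteq\cdots\subseteq\nu^{(n-1)}\subseteq\nu^{(n)}:=\mu'$$ and, for every $1\le a\le n$, $\nu^{(a)}/\nu^{(a-1)}$ is a horizontal strip of length $\lambda_a$, i.e. it has exactly $\lambda_a$ cells and at most one cell in each column. -/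

import Mathlib

open Polynomial

noncomputable section

/-! ### Schur and Hall–Littlewood polynomials in finitely many variables

Both live in the field of rational functions in `x_0, …, x_{N-1}` over the domain `ℤ[q]`. The
polynomial variable `X : ℤ[X]` plays the role of the parameter `q`. -/

/-- The field of fractions of `ℤ[q][x_0, …, x_{N-1}]`. -/
abbrev RatFunField (N : ℕ) : Type :=
  FractionRing (MvPolynomial (Fin N) ℤ[X])

/-- The variable `x_i`, as a rational function. -/
def varX {N : ℕ} (i : Fin N) : RatFunField N :=
  algebraMap (MvPolynomial (Fin N) ℤ[X]) (RatFunField N) (MvPolynomial.X i)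

/-- A polynomial in `q`, as a constant rational function of the `x_i`. -/
def constQ (N : ℕ) (p : ℤ[X]) : RatFunField N :=
  algebraMap (MvPolynomial (Fin N) ℤ[X]) (RatFunField N) (MvPolynomial.C p)

/-- The alternant `a_α = det (x_i ^ α_j)`. -/
def alternant {N : ℕ} (α : Fin N → ℕ) : RatFunField N :=
  Matrix.det (Matrix.of fun i j : Fin N => varX i ^ α j)

/-- The Schur polynomial `s_l(x_0, …, x_{N-1}) = a_{l+δ} / a_δ`, with `δ = (N-1, …, 1, 0)`, of a
partition `l` with at most `N` parts. -/
def schurPoly {N : ℕ} (l : Fin N → ℕ) : RatFunField N :=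
  alternant (fun j => l j + (N - 1 - (j : ℕ))) / alternant (fun j : Fin N => N - 1 - (j : ℕ))

/-- `v_m(q) = ∏_{i=1}^m (1 - q^i) / (1 - q)`, written without division. -/
def hallLittlewoodV (m : ℕ) : ℤ[X] :=
  ∏ i ∈ Finset.range m, ∑ j ∈ Finset.range (i + 1), X ^ j

/-- The Hall–Littlewood polynomial of a partition `l` with at most `N` parts (zeros allowed),
`P_l(x; q) = v_l(q)⁻¹ ∑_{w ∈ S_N} w (x^l ∏_{i<j} (x_i - q x_j) / (x_i - x_j))`,
where `v_l = ∏_{k ≥ 0} v_{m_k}` and `m_k` is the number of indices `i` with `l i = k`. -/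
def hallLittlewoodP {N : ℕ} (l : Fin N → ℕ) : RatFunField N :=
  (constQ N (∏ k ∈ Finset.univ.image l,
      hallLittlewoodV (Finset.univ.filter fun i => l i = k).card))⁻¹ *
    ∑ w : Equiv.Perm (Fin N),
      (∏ i, varX (w i) ^ l i) *
        ∏ i, ∏ j ∈ Finset.Ioi i,
          (varX (w i) - constQ N X * varX (w j)) / (varX (w i) - varX (w j))

/-! ### Finite sets of Young diagrams -/

theorem finite_youngDiagrams_le (κ : YoungDiagram) : {ν : YoungDiagram | ν ≤ κ}.Finite := by
  refine Set.Finite.of_finite_image (f := YoungDiagram.cells) ?_ ?_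
  · refine (Finset.finite_toSet κ.cells.powerset).subset ?_
    rintro _ ⟨ν, hν, rfl⟩
    simpa using YoungDiagram.cells_subset_iff.2 hν
  · intro a _ b _ h
    exact YoungDiagram.ext h

theorem finite_youngDiagrams_card (m : ℕ) : {ν : YoungDiagram | ν.card = m}.Finite := by
  refine Set.Finite.of_finite_image (f := YoungDiagram.cells) ?_ ?_
  · refine (Finset.finite_toSet (Finset.range m ×ˢ Finset.range m).powerset).subset ?_
    rintro _ ⟨ν, hν, rfl⟩
    have hν' : ν.card = m := hν
    simp only [Finset.coe_powerset, Set.mem_preimage, Set.mem_powerset_iff, Finset.coe_subset]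
    rintro ⟨i, j⟩ hc
    have h : (i, j) ∈ ν := hc
    have h1 : i < ν.colLen j := YoungDiagram.mem_iff_lt_colLen.1 h
    have h2 : j < ν.rowLen i := YoungDiagram.mem_iff_lt_rowLen.1 h
    have h3 : ν.colLen j ≤ ν.card := by
      rw [YoungDiagram.colLen_eq_card]; exact Finset.card_filter_le _ _
    have h4 : ν.rowLen i ≤ ν.card := by
      rw [YoungDiagram.rowLen_eq_card]; exact Finset.card_filter_le _ _
    simp only [Finset.mem_product, Finset.mem_range]
    omega
  · intro a _ b _ h
    exact YoungDiagram.ext h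

/-- The finite set of Young diagrams (partitions) with `m` cells. -/
def youngDiagramsOfCard (m : ℕ) : Finset YoungDiagram :=
  (finite_youngDiagrams_card m).toFinset

@[simp]
theorem mem_youngDiagramsOfCard {m : ℕ} {ν : YoungDiagram} :
    ν ∈ youngDiagramsOfCard m ↔ ν.card = m := by
  simp [youngDiagramsOfCard]

/-! ### Kostka–Foulkes polynomials and Kostka numbers -/

/-- The first `N` parts of a partition, as a vector of length `N`. -/
def partsVec (N : ℕ) (ξ : YoungDiagram) : Fin N → ℕ :=
  fun i => ξ.rowLen i

/-- `K` is the row of the Schur to Hall–Littlewood transition matrix indexed by `ξ`: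
`s_ξ(x) = ∑_{|η| = |ξ|} K_η(q) P_η(x; q)`, and `K_η = 0` for all other `η`.
In degree `|ξ|` an identity of symmetric functions is the same as one of symmetric polynomials in
`|ξ|` variables, and every partition of `|ξ|` has at most `|ξ|` parts. -/
def IsKostkaFoulkesRow (ξ : YoungDiagram) (K : YoungDiagram → ℤ[X]) : Prop :=
  (∀ η : YoungDiagram, η.card ≠ ξ.card → K η = 0) ∧
    schurPoly (partsVec ξ.card ξ) =
      ∑ η ∈ youngDiagramsOfCard ξ.card,
        constQ ξ.card (K η) * hallLittlewoodP (partsVec ξ.card η)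

open Classical in
/-- The Kostka–Foulkes polynomial `K_{ξη}(q)`, an entry of the transition matrix from Hall–Littlewood
to Schur functions. The Hall–Littlewood polynomials form a basis of the symmetric polynomials over
`ℤ[q]`, so exactly one row `K` as in `IsKostkaFoulkesRow` exists. -/
def kostkaFoulkes (ξ η : YoungDiagram) : ℤ[X] :=
  if h : ∃ K : YoungDiagram → ℤ[X], IsKostkaFoulkesRow ξ K then h.choose η else 0

/-- The partition obtained by arranging the components of a composition in weakly decreasing
order. -/
def sortedDiagram {n : ℕ} (c : Fin n → ℕ) : YoungDiagram :=
  YoungDiagram.ofRowLens ((Multiset.map c Finset.univ.val).sort (· ≥ ·))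
    (List.Pairwise.sortedGE (Multiset.pairwise_sort _ _))

/-- The Kostka number `K_{ξc} = K_{ξc}(1)` of a partition `ξ` and a composition `c`; it is extended
from partitions to compositions by invariance under permutations of the components of `c`. -/
def kostkaNumber {n : ℕ} (ξ : YoungDiagram) (c : Fin n → ℕ) : ℤ :=
  (kostkaFoulkes ξ (sortedDiagram c)).eval 1

/-! ### Gaussian binomial coefficients -/

/-- `(q)_m = ∏_{i=1}^m (1 - q^i)`, in the field of fractions of `ℤ[q]`. -/
def qFactor (m : ℕ) : FractionRing ℤ[X] :=
  ∏ i ∈ Finset.range m, (1 - algebraMap ℤ[X] (FractionRing ℤ[X]) X ^ (i + 1))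

/-- The Gaussian binomial coefficient with top entry `m` and bottom entry `k`: it is
`(q)_m / ((q)_k (q)_{m-k})` if `0 ≤ k ≤ m`, and `0` otherwise. -/
def qBinom (m k : ℤ) : FractionRing ℤ[X] :=
  if 0 ≤ k ∧ k ≤ m then
    qFactor m.toNat / (qFactor k.toNat * qFactor (m - k).toNat)
  else 0

/-! ### Chains of horizontal strips -/

/-- `β / α` is a horizontal strip of length `m`: `α ⊆ β`, and the skew diagram `β / α` has `m` cells
and at most one cell in each column. -/
def IsHorizontalStrip (α β : YoungDiagram) (m : ℕ) : Prop :=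
  α ≤ β ∧ (β.cells \ α.cells).card = m ∧
    ∀ j : ℕ, ((β.cells \ α.cells).filter fun c => c.2 = j).card ≤ 1

/-- Sequences `∅ = ν⁽⁰⁾ ⊆ ν⁽¹⁾ ⊆ ⋯ ⊆ ν⁽ⁿ⁾ = κ` of Young diagrams in which `ν⁽ᵃ⁾ / ν⁽ᵃ⁻¹⁾` is a
horizontal strip whose length is the `a`-th component of `c`, for `1 ≤ a ≤ n` (the `a`-th component
has index `a - 1` in `Fin n`). -/
def IsStripChain {n : ℕ} (c : Fin n → ℕ) (κ : YoungDiagram) (ν : Fin (n + 1) → YoungDiagram) :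
    Prop :=
  ν 0 = ⊥ ∧ ν (Fin.last n) = κ ∧ ∀ a : Fin n, IsHorizontalStrip (ν a.castSucc) (ν a.succ) (c a)

theorem finite_stripChains {n : ℕ} (c : Fin n → ℕ) (κ : YoungDiagram) :
    {ν : Fin (n + 1) → YoungDiagram | IsStripChain c κ ν}.Finite := by
  refine (Set.Finite.pi' fun _ : Fin (n + 1) => finite_youngDiagrams_le κ).subset ?_
  rintro ν ⟨-, h1, h2⟩ a
  have hmono : Monotone ν := Fin.monotone_iff_le_succ.2 fun i => (h2 i).1
  exact h1 ▸ hmono (Fin.le_last a)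

/-- The finite set of chains of horizontal strips of lengths `c` from `∅` to `κ`. -/
def stripChains {n : ℕ} (c : Fin n → ℕ) (κ : YoungDiagram) :
    Finset (Fin (n + 1) → YoungDiagram) :=
  (finite_stripChains c κ).toFinset

@[simp]
theorem mem_stripChains {n : ℕ} {c : Fin n → ℕ} {κ : YoungDiagram}
    {ν : Fin (n + 1) → YoungDiagram} : ν ∈ stripChains c κ ↔ IsStripChain c κ ν := by
  simp [stripChains]

end

/-!
# Hall–Littlewood Pieri rule and the chain formula

Both sides of the identity are the coefficient of the Hall–Littlewood polynomial `P_μ` in the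
product `e_λ = ∏_a e_{λ_a}` of elementary symmetric polynomials in `N = |μ|` variables. The formula
follows by comparing two expansions of `e_λ`, since the `P_μ` are linearly independent over `ℤ[q]`
(`linearIndependent_hallLittlewoodP`).

*Chains of strips.* Multiplying out `e_λ` by the Pieri rule for Hall–Littlewood polynomials
(`elemSym_mul_hallLittlewoodP`) gives a sum over chains of horizontal strips of conjugate diagrams
with products of Gaussian binomial coefficients as weights. The Pieri rule has an elementary proof:
if `α_i = α_{i+1}`, then the symmetrization `F(α) = ∑_w w(x^α ∏_{i<j} (x_i - q x_j) / (x_i - x_j))`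
satisfies `F(α + ε_{i+1}) = q F(α + ε_i)` (`straightens_hlKernel`). Since `e_r F(α)` is the sum of
`F(α + 1_S)` over the sets `S` of size `r`, this relation moves the raised entries to the front of
each block of equal parts, and the powers of `q` add up to Gaussian binomials block by block
(`Straightens.sum_powerset_lt`, `Straightens.pieri`).

*Schur functions.* Ratios of alternants satisfy the same relation with `q = 0`, so the same argument
expands `e_λ` in Schur polynomials, with the numbers of chains of strips as coefficients. By the
branching rule for alternants (`alternantAt_partsVec`) such a number is the coefficient of `x^λ` in
the Schur polynomial of the conjugate shape. Since `P_η` specializes to a monomial symmetric function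
at `q = 1`, it is a Kostka number (`eval_one_kostkaFoulkes`). Expanding the Schur polynomials in the
`P_μ` produces the left-hand side.

The same unitriangular expansions of the `e_λ`, combined with the fundamental theorem on symmetric
polynomials, show that the rows defining the Kostka–Foulkes polynomials exist
(`exists_isKostkaFoulkesRow`), that the `P_μ` are polynomials, and that they are linearly
independent.

Diagrams are conjugated throughout: `colVec N κ` lists the column lengths of `κ`, so that adding a
vertical strip to a partition is adding a horizontal strip to `κ`.
-/

open Polynomial

noncomputable section

/-! ### Gaussian binomial coefficients -/

/-- The Gaussian binomial coefficient at an element `q` of a commutative ring, defined by a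
`q`-Pascal recursion, so that it makes sense without division. -/
def gaussBinom {A : Type*} [CommRing A] (q : A) : ℕ → ℕ → A
  | _, 0 => 1
  | 0, _ + 1 => 0
  | m + 1, k + 1 => gaussBinom q m (k + 1) + q ^ (m - k) * gaussBinom q m k

/-- The `q`-factorial `∏_{i=1}^m (1 + q + ⋯ + q^{i-1})`. -/
def gaussFact {A : Type*} [CommRing A] (q : A) (m : ℕ) : A :=
  ∏ i ∈ Finset.range m, ∑ j ∈ Finset.range (i + 1), q ^ j

section Gauss

variable {A : Type*} [CommRing A] (q : A)

@[simp]
theorem gaussBinom_zero_right (m : ℕ) : gaussBinom q m 0 = 1 := by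
  cases m <;> rfl

theorem gaussBinom_succ_succ (m k : ℕ) :
    gaussBinom q (m + 1) (k + 1) = gaussBinom q m (k + 1) + q ^ (m - k) * gaussBinom q m k :=
  rfl

theorem gaussBinom_eq_zero_of_lt {m k : ℕ} (h : m < k) : gaussBinom q m k = 0 := by
  induction m generalizing k with
  | zero => obtain ⟨k, rfl⟩ := Nat.exists_eq_succ_of_ne_zero h.ne'; rfl
  | succ m ih =>
    obtain ⟨k, rfl⟩ := Nat.exists_eq_succ_of_ne_zero (Nat.ne_of_gt (Nat.zero_lt_of_lt h))
    rw [Nat.succ_eq_add_one, gaussBinom_succ_succ, ih (by omega), ih (by omega)]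
    simp

@[simp]
theorem gaussBinom_self (m : ℕ) : gaussBinom q m m = 1 := by
  induction m with
  | zero => rfl
  | succ m ih => rw [gaussBinom_succ_succ, gaussBinom_eq_zero_of_lt q (by omega), ih]; simp

theorem map_gaussBinom {B : Type*} [CommRing B] (f : A →+* B) (m k : ℕ) :
    f (gaussBinom q m k) = gaussBinom (f q) m k := by
  induction m generalizing k with
  | zero => cases k <;> simp [gaussBinom]
  | succ m ih => cases k <;> simp [gaussBinom, ih]

theorem map_gaussFact {B : Type*} [CommRing B] (f : A →+* B) (m : ℕ) :
    f (gaussFact q m) = gaussFact (f q) m := by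
  simp [gaussFact]

@[simp]
theorem gaussFact_zero : gaussFact q 0 = 1 := by simp [gaussFact]

theorem gaussFact_succ (m : ℕ) :
    gaussFact q (m + 1) = gaussFact q m * ∑ j ∈ Finset.range (m + 1), q ^ j := by
  rw [gaussFact, Finset.prod_range_succ, gaussFact]

theorem gaussBinom_mul_gaussFact {m k : ℕ} (h : k ≤ m) :
    gaussBinom q m k * (gaussFact q k * gaussFact q (m - k)) = gaussFact q m := by
  induction m generalizing k with
  | zero => obtain rfl : k = 0 := by omega
            simp
  | succ m ih =>
    cases k with
    | zero => simp
    | succ k =>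
      rcases Nat.lt_or_ge m (k + 1) with h1 | h1
      · obtain rfl : k = m := by omega
        simp
      · obtain ⟨d, rfl⟩ := Nat.exists_eq_add_of_le h1
        have e1 := ih h1
        have e2 := ih (k := k) (by omega)
        rw [show k + 1 + d - (k + 1) = d by omega] at e1
        rw [show k + 1 + d - k = d + 1 by omega] at e2
        rw [gaussBinom_succ_succ, show k + 1 + d + 1 - (k + 1) = d + 1 by omega,
          show k + 1 + d - k = d + 1 by omega, gaussFact_succ q (k + 1 + d),
          show k + 1 + d + 1 = (d + 1) + (k + 1) by omega, Finset.sum_range_add]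
        simp only [pow_add q (d + 1), ← Finset.mul_sum]
        rw [gaussFact_succ q d] at e2 ⊢
        rw [gaussFact_succ q k] at e1 ⊢
        linear_combination (∑ j ∈ Finset.range (d + 1), q ^ j) * e1 +
          q ^ (d + 1) * (∑ j ∈ Finset.range (k + 1), q ^ j) * e2

theorem gaussFact_zero_left (m : ℕ) : gaussFact (0 : A) m = 1 := by
  refine Finset.prod_eq_one fun i _ => ?_
  simp [Finset.sum_range_succ']

theorem gaussBinom_zero_left {m k : ℕ} (h : k ≤ m) : gaussBinom (0 : A) m k = 1 := by
  simpa [gaussFact_zero_left] using gaussBinom_mul_gaussFact (0 : A) h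

theorem gaussFact_one (m : ℕ) : gaussFact (1 : A) m = (m.factorial : A) := by
  simp only [gaussFact, one_pow, Finset.sum_const, Finset.card_range, nsmul_eq_mul, mul_one]
  rw [← Finset.prod_range_add_one_eq_factorial]
  push_cast
  rfl

theorem gaussFact_X_ne_zero (m : ℕ) : gaussFact (X : ℤ[X]) m ≠ 0 := by
  intro h
  have := congrArg (evalRingHom (1 : ℤ)) h
  rw [map_gaussFact, coe_evalRingHom, eval_X, gaussFact_one, eval_zero] at this
  exact Nat.factorial_ne_zero m (by exact_mod_cast this)

theorem hallLittlewoodV_eq (m : ℕ) : hallLittlewoodV m = gaussFact X m := rfl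

theorem qFactor_eq (m : ℕ) :
    qFactor m = (1 - algebraMap ℤ[X] (FractionRing ℤ[X]) X) ^ m *
      algebraMap ℤ[X] (FractionRing ℤ[X]) (gaussFact X m) := by
  rw [map_gaussFact, qFactor, gaussFact, ← Finset.card_range m, ← Finset.prod_const,
    Finset.card_range, ← Finset.prod_mul_distrib]
  refine Finset.prod_congr rfl fun i _ => ?_
  rw [mul_neg_geom_sum]

theorem qBinom_eq {m k : ℕ} (h : k ≤ m) :
    qBinom (m : ℤ) ((m : ℤ) - (k : ℤ)) =
      algebraMap ℤ[X] (FractionRing ℤ[X]) (gaussBinom X m k) := by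
  have hX : (1 - algebraMap ℤ[X] (FractionRing ℤ[X]) X) ≠ 0 := by
    intro h0
    rw [← map_one (algebraMap ℤ[X] (FractionRing ℤ[X])), ← map_sub] at h0
    have := (IsFractionRing.injective ℤ[X] (FractionRing ℤ[X])) (h0.trans (map_zero _).symm)
    have := congrArg (eval 0) this
    simp at this
  have hf : ∀ i, algebraMap ℤ[X] (FractionRing ℤ[X]) (gaussFact X i) ≠ 0 := fun i h0 =>
    gaussFact_X_ne_zero i ((IsFractionRing.injective ℤ[X] (FractionRing ℤ[X]))
      (h0.trans (map_zero _).symm))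
  have hmk : (m : ℤ) - k = ((m - k : ℕ) : ℤ) := by omega
  have hmk' : (m : ℤ) - ((m - k : ℕ) : ℤ) = ((k : ℕ) : ℤ) := by omega
  rw [qBinom, hmk, hmk', if_pos (by omega)]
  simp only [Int.toNat_natCast]
  rw [div_eq_iff (by
    simp only [qFactor_eq]
    exact mul_ne_zero (mul_ne_zero (pow_ne_zero _ hX) (hf _))
      (mul_ne_zero (pow_ne_zero _ hX) (hf _)))]
  rw [qFactor_eq, qFactor_eq, qFactor_eq, ← gaussBinom_mul_gaussFact X h, map_mul, map_mul]
  have : (1 - algebraMap ℤ[X] (FractionRing ℤ[X]) X) ^ m =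
      (1 - algebraMap ℤ[X] (FractionRing ℤ[X]) X) ^ (m - k) *
      (1 - algebraMap ℤ[X] (FractionRing ℤ[X]) X) ^ k := by
    rw [← pow_add, Nat.sub_add_cancel h]
  rw [this]
  ring

end Gauss

/-! ### Sorting zero-one vectors inside the blocks of a partition -/

section Blocks

variable {N : ℕ}

/-- The zero-one vector of a set of positions. -/
def zeroOne (S : Finset (Fin N)) : Fin N → ℕ :=
  fun i => if i ∈ S then 1 else 0

/-- The `m` consecutive positions starting at `s`. -/
def block (N s m : ℕ) : Finset (Fin N) :=
  Finset.univ.filter fun i => s ≤ (i : ℕ) ∧ (i : ℕ) < s + m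

theorem mem_block {s m : ℕ} {i : Fin N} : i ∈ block N s m ↔ s ≤ (i : ℕ) ∧ (i : ℕ) < s + m := by
  simp [block]

theorem zeroOne_union {S T : Finset (Fin N)} (h : Disjoint S T) :
    zeroOne (S ∪ T) = zeroOne S + zeroOne T := by
  funext i
  have : i ∈ S → i ∉ T := fun h' => Finset.disjoint_left.1 h h'
  simp only [zeroOne, Finset.mem_union, Pi.add_apply]
  split_ifs <;> simp_all

theorem zeroOne_singleton (x : Fin N) : zeroOne {x} = Pi.single x 1 := by
  funext i
  simp [zeroOne, Pi.single_apply]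

theorem sum_zeroOne (S : Finset (Fin N)) : ∑ i, zeroOne S i = S.card := by
  simp [zeroOne]

theorem block_succ {s m : ℕ} (h : s + m < N) :
    block N s (m + 1) = insert ⟨s + m, h⟩ (block N s m) := by
  ext i
  simp only [mem_block, Finset.mem_insert, Fin.ext_iff]
  omega

theorem notMem_block {s m : ℕ} (h : s + m < N) : (⟨s + m, h⟩ : Fin N) ∉ block N s m := by
  simp [mem_block]

theorem card_block {s m : ℕ} (h : s + m ≤ N) : (block N s m).card = m := by
  induction m with
  | zero => rw [Finset.card_eq_zero]; ext i; simp [mem_block]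
  | succ m ih =>
    rw [block_succ (by omega), Finset.card_insert_of_notMem (notMem_block _), ih (by omega)]

variable {A : Type*} [CommRing A]

/-- A function `F` of exponent vectors straightens with parameter `q` when raising the right one of
two equal adjacent exponents gives `q` times the effect of raising the left one. -/
def Straightens (q : A) (F : (Fin N → ℕ) → A) : Prop :=
  ∀ (α : Fin N → ℕ) (i j : Fin N), (i : ℕ) + 1 = j → α i = α j →
    F (α + Pi.single j 1) = q * F (α + Pi.single i 1)

variable {q : A} {F : (Fin N → ℕ) → A}

theorem Straightens.move (hF : Straightens q F) (α : Fin N → ℕ) (d : ℕ) :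
    ∀ i j : Fin N, (i : ℕ) + d = j → (∀ k, i ≤ k → k ≤ j → α k = α i) →
      F (α + Pi.single j 1) = q ^ d * F (α + Pi.single i 1) := by
  induction d with
  | zero =>
    intro i j h _
    obtain rfl : i = j := Fin.ext (by omega)
    simp
  | succ d ih =>
    intro i j h hα
    have hj := j.isLt
    let j' : Fin N := ⟨i + d, by omega⟩
    have h1 := ih i j' rfl fun k hk hk' => hα k hk (hk'.trans (by
      rw [Fin.le_def]; simp only [j']; omega))
    have h2 := hF α j' j (by simp only [j']; omega) (by
      rw [hα j' (by rw [Fin.le_def]; simp [j']) (by rw [Fin.le_def]; simp only [j']; omega),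
        hα j (by rw [Fin.le_def]; omega) le_rfl])
    rw [h2, h1]
    ring

/-- Raising any `r` of the entries of a constant block amounts to raising its first `r` entries,
with a Gaussian binomial coefficient as multiplicity. The induction on the length of the block is
the `q`-Pascal recursion. -/
theorem Straightens.sum_powersetCard_block (hF : Straightens q F) (s m : ℕ) (hm : s + m ≤ N) :
    ∀ (r : ℕ) (β : Fin N → ℕ), (∀ i ∈ block N s m, ∀ j ∈ block N s m, β i = β j) →
      ∑ S ∈ (block N s m).powersetCard r, F (β + zeroOne S) =
        gaussBinom q m r * F (β + zeroOne (block N s r)) := by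
  induction m with
  | zero =>
    intro r β _
    have h0 : block N s 0 = ∅ := by ext i; simp [mem_block]
    rw [h0]
    cases r with
    | zero => simp [h0]
    | succ r =>
      rw [gaussBinom_eq_zero_of_lt q (by omega), Finset.powersetCard_eq_empty.2 (by simp)]
      simp
  | succ m ih =>
    intro r β hβ
    cases r with
    | zero =>
      have h0 : block N s 0 = ∅ := by ext i; simp [mem_block]
      simp [h0]
    | succ r =>
      have hx : s + m < N := by omega
      rw [block_succ hx] at hβ ⊢
      have hnot := notMem_block hx
      have hβ' : ∀ i ∈ block N s m, ∀ j ∈ block N s m, β i = β j := fun i hi j hj =>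
        hβ i (Finset.mem_insert_of_mem hi) j (Finset.mem_insert_of_mem hj)
      rw [Finset.powersetCard_succ_insert hnot, Finset.sum_union, Finset.sum_image,
        ih (by omega) _ _ hβ']
      · have e : ∀ S ∈ (block N s m).powersetCard r, F (β + zeroOne (insert ⟨s + m, hx⟩ S)) =
            F ((β + Pi.single ⟨s + m, hx⟩ 1) + zeroOne S) := by
          intro S hS
          have : (⟨s + m, hx⟩ : Fin N) ∉ S := fun h => hnot ((Finset.mem_powersetCard.1 hS).1 h)
          rw [Finset.insert_eq, zeroOne_union (by simpa using this), zeroOne_singleton, add_assoc]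
        rw [Finset.sum_congr rfl e, ih (by omega) _ _ ?_, gaussBinom_succ_succ, add_mul]
        · congr 1
          rcases Nat.lt_or_ge m r with hr | hr
          · rw [gaussBinom_eq_zero_of_lt q hr]; simp
          · have h3 := hF.move (β + zeroOne (block N s r)) (m - r) ⟨s + r, by omega⟩ ⟨s + m, hx⟩
              (by simp only; omega) (by
                intro k hk hk'
                rw [Fin.le_def] at hk hk'
                simp only at hk hk'
                have h4 : β k = β ⟨s + r, by omega⟩ := by
                  apply hβ <;>
                  · simp only [Finset.mem_insert, mem_block, Fin.ext_iff]
                    omega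
                have h5 : k ∉ block N s r := by rw [mem_block]; omega
                have h6 : (⟨s + r, by omega⟩ : Fin N) ∉ block N s r := by simp [mem_block]
                simp [zeroOne, h4, h5, h6])
            rw [add_right_comm, h3, block_succ (m := r) (by omega), Finset.insert_eq,
              zeroOne_union (by simpa using notMem_block _), zeroOne_singleton, add_assoc β,
              add_comm (zeroOne _)]
            ring
        · intro i hi j hj
          have h1 : i ≠ ⟨s + m, hx⟩ := fun h => hnot (h ▸ hi)
          have h2 : j ≠ ⟨s + m, hx⟩ := fun h => hnot (h ▸ hj)
          simp [h1, h2, hβ' i hi j hj]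
      · intro S hS T hT h
        have h1 : (⟨s + m, hx⟩ : Fin N) ∉ S := fun h => hnot ((Finset.mem_powersetCard.1 hS).1 h)
        have h2 : (⟨s + m, hx⟩ : Fin N) ∉ T := fun h => hnot ((Finset.mem_powersetCard.1 hT).1 h)
        rw [← Finset.erase_insert h1, ← Finset.erase_insert h2, h]
      · rw [Finset.disjoint_left]
        intro S hS hS'
        obtain ⟨T, -, rfl⟩ := Finset.mem_image.1 hS'
        exact hnot ((Finset.mem_powersetCard.1 hS).1 (Finset.mem_insert_self _ _))

/-- A down-closed set of positions is an initial segment. -/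
theorem mem_iff_lt_card_of_lower (S : Finset (Fin N)) (hS : ∀ i ∈ S, ∀ j ≤ i, j ∈ S) (i : Fin N) :
    i ∈ S ↔ (i : ℕ) < S.card := by
  constructor
  · intro hi
    have : Finset.Iic i ⊆ S := fun j hj => hS i hi j (Finset.mem_Iic.1 hj)
    have := Finset.card_le_card this
    rw [Fin.card_Iic] at this
    omega
  · intro hi
    by_contra hc
    have : S ⊆ Finset.Iio i := by
      intro j hj
      rw [Finset.mem_Iio]
      by_contra h
      exact hc (hS j hj i (not_lt.1 h))
    have := Finset.card_le_card this
    rw [Fin.card_Iio] at this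
    omega

/-- The positions at which a partition takes a given value are consecutive. -/
theorem filter_eq_block {l : Fin N → ℕ} (hl : Antitone l) (k : ℕ) :
    ∃ s, s + (Finset.univ.filter fun i => l i = k).card ≤ N ∧
      (Finset.univ.filter fun i => l i = k) =
        block N s (Finset.univ.filter fun i => l i = k).card := by
  have hU := mem_iff_lt_card_of_lower (Finset.univ.filter fun i => k ≤ l i) (by
    intro i hi j hj
    simp only [Finset.mem_filter, Finset.mem_univ, true_and] at hi ⊢
    exact hi.trans (hl hj))
  have hV := mem_iff_lt_card_of_lower (Finset.univ.filter fun i => k < l i) (by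
    intro i hi j hj
    simp only [Finset.mem_filter, Finset.mem_univ, true_and] at hi ⊢
    exact hi.trans_le (hl hj))
  have hc : (Finset.univ.filter fun i => k < l i).card +
      (Finset.univ.filter fun i => l i = k).card = (Finset.univ.filter fun i => k ≤ l i).card := by
    rw [← Finset.card_union_of_disjoint]
    · congr 1; ext i
      simp only [Finset.mem_union, Finset.mem_filter, Finset.mem_univ, true_and]
      omega
    · rw [Finset.disjoint_filter]; intro i _ h; omega
  refine ⟨(Finset.univ.filter fun i => k < l i).card, ?_, ?_⟩
  · rw [hc]
    exact (Finset.card_le_univ _).trans (by simp)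
  · ext i
    rw [mem_block, hc, ← hU, ← not_lt, ← hV]
    simp only [Finset.mem_filter, Finset.mem_univ, true_and]
    omega

/-- `S` is flush with the blocks of `l` if it meets each block `{i | l i = k}` in an initial
segment; for a partition `l` this says that `l + zeroOne S` is again a partition. -/
def Flush (l : Fin N → ℕ) (S : Finset (Fin N)) : Prop :=
  ∀ i ∈ S, ∀ j ≤ i, l j = l i → j ∈ S

theorem sum_powerset_union {ι M : Type*} [DecidableEq ι] [AddCommMonoid M] {S T : Finset ι}
    (h : Disjoint S T) (G : Finset ι → M) :
    ∑ U ∈ (S ∪ T).powerset, G U = ∑ U ∈ S.powerset, ∑ V ∈ T.powerset, G (U ∪ V) := by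
  rw [← Finset.sum_product']
  have hd : ∀ x ∈ T, x ∉ S := fun x hx hx' => Finset.disjoint_left.1 h hx' hx
  refine Finset.sum_nbij' (fun U => (U ∩ S, U ∩ T)) (fun p => p.1 ∪ p.2) ?_ ?_ ?_ ?_ ?_
  · intro U _
    simp [Finset.inter_subset_right]
  · intro p hp
    simp only [Finset.mem_product, Finset.mem_powerset] at hp ⊢
    exact Finset.union_subset_union hp.1 hp.2
  · intro U hU
    rw [← Finset.inter_union_distrib_left, Finset.inter_eq_left]
    exact Finset.mem_powerset.1 hU
  · rintro ⟨U, V⟩ hp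
    simp only [Finset.mem_product, Finset.mem_powerset] at hp
    ext x
    · simp only [Finset.mem_inter, Finset.mem_union]
      exact ⟨fun hx => hx.1.resolve_right fun hv => hd x (hp.2 hv) hx.2,
        fun hx => ⟨Or.inl hx, hp.1 hx⟩⟩
    · simp only [Finset.mem_inter, Finset.mem_union]
      exact ⟨fun hx => hx.1.resolve_left fun hv => hd x hx.2 (hp.1 hv),
        fun hx => ⟨Or.inr hx, hp.2 hx⟩⟩
  · intro U hU
    rw [← Finset.inter_union_distrib_left, Finset.inter_eq_left.2 (Finset.mem_powerset.1 hU)]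

open Classical in
/-- Raising an arbitrary set of entries of a partition `l` amounts to raising a set flush with the
blocks of `l`, with a Gaussian binomial coefficient as multiplicity for each block. The induction
treats one block of equal parts at a time, starting with the smallest part; `β` collects the changes
already made in the blocks of larger parts. -/
theorem Straightens.sum_powerset_lt (hF : Straightens q F) {l : Fin N → ℕ} (hl : Antitone l)
    (K : ℕ) : ∀ β : Fin N → ℕ, (∀ i, l i < K → β i = l i) →
      ∑ S ∈ (Finset.univ.filter fun i => l i < K).powerset, F (β + zeroOne S) =
        ∑ S ∈ (Finset.univ.filter fun i => l i < K).powerset.filter (Flush l),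
          (∏ k ∈ Finset.range K, gaussBinom q (Finset.univ.filter fun i => l i = k).card
            (S.filter fun i => l i = k).card) * F (β + zeroOne S) := by
  induction K with
  | zero =>
    intro β _
    simp [Finset.sum_filter, Flush]
  | succ K ih =>
    intro β hβ
    obtain ⟨s, hs, hB⟩ := filter_eq_block hl K
    set m := (Finset.univ.filter fun i => l i = K).card with hm
    have hunion : (Finset.univ.filter fun i => l i < K + 1) =
        (Finset.univ.filter fun i => l i < K) ∪ block N s m := by
      rw [← hB]; ext i
      simp only [Finset.mem_union, Finset.mem_filter, Finset.mem_univ, true_and]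
      omega
    have hdisj : Disjoint (Finset.univ.filter fun i => l i < K) (block N s m) := by
      rw [← hB, Finset.disjoint_filter]; intro i _ h; omega
    have hBl : ∀ i, i ∈ block N s m ↔ l i = K := fun i => by rw [← hB]; simp
    have hsub : ∀ r ≤ m, block N s r ⊆ block N s m := fun r hr i => by
      simp only [mem_block]; omega
    have hdisj' : ∀ S1 ⊆ (Finset.univ.filter fun i => l i < K), ∀ r ≤ m,
        Disjoint S1 (block N s r) := fun S1 h1 r hr =>
      Finset.disjoint_of_subset_left h1 (Finset.disjoint_of_subset_right (hsub r hr) hdisj)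
    have step1 : ∀ S1 ∈ (Finset.univ.filter fun i => l i < K).powerset,
        ∑ S2 ∈ (block N s m).powerset, F (β + zeroOne (S1 ∪ S2)) =
          ∑ r ∈ Finset.range (m + 1), gaussBinom q m r *
            F ((β + zeroOne (block N s r)) + zeroOne S1) := by
      intro S1 hS1
      rw [Finset.mem_powerset] at hS1
      rw [Finset.sum_powerset, card_block hs]
      refine Finset.sum_congr rfl fun r _ => ?_
      rw [add_right_comm, ← hF.sum_powersetCard_block s m hs r (β + zeroOne S1)]
      · refine Finset.sum_congr rfl fun S2 hS2 => ?_
        rw [zeroOne_union (Finset.disjoint_of_subset_left hS1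
          (Finset.disjoint_of_subset_right (Finset.mem_powersetCard.1 hS2).1 hdisj)), add_assoc]
      · intro i hi j hj
        have hi' : i ∉ S1 := fun h => Finset.disjoint_left.1 hdisj (hS1 h) hi
        have hj' : j ∉ S1 := fun h => Finset.disjoint_left.1 hdisj (hS1 h) hj
        rw [hBl] at hi hj
        simp [zeroOne, hi', hj', hβ i (by omega), hβ j (by omega), hi, hj]
    rw [hunion, sum_powerset_union hdisj, Finset.sum_congr rfl step1, Finset.sum_comm]
    have step2 : ∀ r ∈ Finset.range (m + 1),
        ∑ S1 ∈ (Finset.univ.filter fun i => l i < K).powerset,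
          gaussBinom q m r * F ((β + zeroOne (block N s r)) + zeroOne S1) =
        ∑ S1 ∈ (Finset.univ.filter fun i => l i < K).powerset.filter (Flush l),
          (gaussBinom q m r * ∏ k ∈ Finset.range K,
            gaussBinom q (Finset.univ.filter fun i => l i = k).card
              (S1.filter fun i => l i = k).card) * F (β + zeroOne (S1 ∪ block N s r)) := by
      intro r hr
      rw [← Finset.mul_sum, ih, Finset.mul_sum]
      · refine Finset.sum_congr rfl fun S1 hS1 => ?_
        rw [zeroOne_union (hdisj' S1 (Finset.mem_powerset.1 (Finset.mem_filter.1 hS1).1) r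
          (by simpa [Nat.lt_succ_iff] using hr)), add_comm (zeroOne S1), add_assoc, mul_assoc]
      · intro i hi
        have : i ∉ block N s r := fun h => by
          have := (hBl i).1 (hsub r (by simpa [Nat.lt_succ_iff] using hr) h)
          omega
        simp [zeroOne, this, hβ i (by omega)]
    rw [Finset.sum_congr rfl step2, ← Finset.sum_product']
    have hcardr : ∀ r ≤ m, (block N s r).card = r := fun r hr => card_block (by omega)
    have hfl : ∀ S1 ⊆ (Finset.univ.filter fun i => l i < K), ∀ r ≤ m,
        ((S1 ∪ block N s r).filter fun i => l i = K) = block N s r := by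
      intro S1 h1 r hr
      ext i
      simp only [Finset.mem_filter, Finset.mem_union]
      refine ⟨fun h => h.1.resolve_left fun h' => ?_, fun h => ⟨Or.inr h, (hBl i).1 (hsub r hr h)⟩⟩
      have := (Finset.mem_filter.1 (h1 h')).2
      omega
    have hfl' : ∀ S1 ⊆ (Finset.univ.filter fun i => l i < K), ∀ r ≤ m, ∀ k < K,
        ((S1 ∪ block N s r).filter fun i => l i = k) = S1.filter fun i => l i = k := by
      intro S1 h1 r hr k hk
      ext i
      simp only [Finset.mem_filter, Finset.mem_union]
      refine ⟨fun h => ⟨h.1.resolve_right fun h' => ?_, h.2⟩, fun h => ⟨Or.inl h.1, h.2⟩⟩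
      have := (hBl i).1 (hsub r hr h')
      omega
    refine Finset.sum_nbij' (fun p => p.2 ∪ block N s p.1)
      (fun S => ((S.filter fun i => l i = K).card, S.filter fun i => l i < K)) ?_ ?_ ?_ ?_ ?_
    · rintro ⟨r, S1⟩ hp
      simp only [Finset.mem_product, Finset.mem_range, Finset.mem_filter,
        Finset.mem_powerset] at hp ⊢
      obtain ⟨hr, h1, h2⟩ := hp
      refine ⟨Finset.union_subset_union h1 (hsub r (by omega)), ?_⟩
      intro i hi j hj hij
      rw [Finset.mem_union] at hi ⊢
      rcases hi with hi | hi
      · exact Or.inl (h2 i hi j hj hij)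
      · right
        have h3 := (hBl j).2 (hij.trans ((hBl i).1 (hsub r (by omega) hi)))
        rw [Fin.le_def] at hj
        rw [mem_block] at hi h3 ⊢
        omega
    · intro S hS
      simp only [Finset.mem_product, Finset.mem_range, Finset.mem_filter,
        Finset.mem_powerset] at hS ⊢
      refine ⟨?_, ?_, ?_⟩
      · rw [Nat.lt_succ_iff, hm]
        exact Finset.card_le_card (Finset.filter_subset_filter _ (Finset.subset_univ _))
      · intro i hi
        simpa using (Finset.mem_filter.1 hi).2
      · intro i hi j hj hij
        rw [Finset.mem_filter] at hi ⊢
        exact ⟨hS.2 i hi.1 j hj hij, hij ▸ hi.2⟩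
    · rintro ⟨r, S1⟩ hp
      simp only [Finset.mem_product, Finset.mem_range, Finset.mem_filter,
        Finset.mem_powerset] at hp
      obtain ⟨hr, h1, h2⟩ := hp
      simp only [hfl S1 h1 r (by omega), hcardr r (by omega), Prod.mk.injEq, true_and]
      ext i
      simp only [Finset.mem_filter, Finset.mem_union]
      refine ⟨fun h => h.1.resolve_right fun h' => ?_,
        fun h => ⟨Or.inl h, (Finset.mem_filter.1 (h1 h)).2⟩⟩
      have := (hBl i).1 (hsub r (by omega) h')
      omega
    · intro S hS
      simp only [Finset.mem_filter, Finset.mem_powerset] at hS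
      obtain ⟨h1, h2⟩ := hS
      -- the part of `S` in the block of value `K` is an initial segment of that block
      have hseg : (S.filter fun i => l i = K) =
          block N s (S.filter fun i => l i = K).card := by
        have hlow := mem_iff_lt_card_of_lower
          ((S.filter fun i => l i = K) ∪ block N 0 s) (by
            intro i hi j hj
            rw [Fin.le_def] at hj
            simp only [Finset.mem_union, Finset.mem_filter, ← hBl, mem_block] at hi ⊢
            rcases lt_or_ge (j : ℕ) s with h | h
            · right; omega
            · left
              have hi' := hi.resolve_right (by omega)
              have hjB : s ≤ (j : ℕ) ∧ (j : ℕ) < s + m := by omega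
              refine ⟨h2 i hi'.1 j (Fin.le_def.2 hj) ?_, hjB⟩
              rw [(hBl j).1 (mem_block.2 hjB), (hBl i).1 (mem_block.2 hi'.2)])
        rw [Finset.card_union_of_disjoint, card_block (by omega)] at hlow
        · ext i
          have := hlow i
          simp only [Finset.mem_union, Finset.mem_filter, ← hBl, mem_block] at this ⊢
          grind
        · rw [Finset.disjoint_left]
          intro i hi hi'
          simp only [Finset.mem_filter, ← hBl, mem_block] at hi hi'
          omega
      rw [← hseg]
      ext i
      simp only [Finset.mem_union, Finset.mem_filter]
      refine ⟨fun h => h.elim And.left And.left, fun h => ?_⟩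
      have := h1 h
      rw [← hunion, Finset.mem_filter] at this
      rcases Nat.lt_or_ge (l i) K with h' | h'
      · exact Or.inl ⟨h, h'⟩
      · exact Or.inr ⟨h, by omega⟩
    · rintro ⟨r, S1⟩ hp
      simp only [Finset.mem_product, Finset.mem_range, Finset.mem_filter,
        Finset.mem_powerset] at hp
      obtain ⟨hr, h1, h2⟩ := hp
      rw [Finset.prod_range_succ, ← hm, hfl S1 h1 r (by omega), hcardr r (by omega),
        mul_comm (gaussBinom q m r)]
      congr 2
      refine Finset.prod_congr rfl fun k hk => ?_
      rw [hfl' S1 h1 r (by omega) k (Finset.mem_range.1 hk)]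

end Blocks

/-! ### Horizontal strips in terms of row lengths -/

section Young

theorem lt_colLen_iff (ν : YoungDiagram) {i k : ℕ} : i < ν.colLen k ↔ k < ν.rowLen i := by
  rw [← YoungDiagram.mem_iff_lt_colLen, ← YoungDiagram.mem_iff_lt_rowLen]

theorem rowLen_eq_zero {ν : YoungDiagram} {k : ℕ} (h : ν.colLen 0 ≤ k) : ν.rowLen k = 0 := by
  have := lt_colLen_iff ν (i := k) (k := 0)
  omega

theorem colLen_eq_zero {ν : YoungDiagram} {k : ℕ} (h : ν.rowLen 0 ≤ k) : ν.colLen k = 0 := by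
  have := lt_colLen_iff ν (i := 0) (k := k)
  omega

theorem le_iff_rowLen_le {ν κ : YoungDiagram} : ν ≤ κ ↔ ∀ k, ν.rowLen k ≤ κ.rowLen k := by
  constructor
  · intro h k
    by_contra hc
    have h1 : (k, κ.rowLen k) ∈ ν := YoungDiagram.mem_iff_lt_rowLen.2 (not_le.1 hc)
    have h2 : (k, κ.rowLen k) ∈ κ := h h1
    exact lt_irrefl _ (YoungDiagram.mem_iff_lt_rowLen.1 h2)
  · rintro h ⟨i, j⟩ hc
    exact YoungDiagram.mem_iff_lt_rowLen.2 ((YoungDiagram.mem_iff_lt_rowLen.1 hc).trans_le (h i))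

theorem ext_rowLen {ν κ : YoungDiagram} (h : ∀ k, ν.rowLen k = κ.rowLen k) : ν = κ :=
  le_antisymm (le_iff_rowLen_le.2 fun k => (h k).le) (le_iff_rowLen_le.2 fun k => (h k).ge)

theorem le_iff_colLen_le {ν κ : YoungDiagram} : ν ≤ κ ↔ ∀ k, ν.colLen k ≤ κ.colLen k := by
  rw [← YoungDiagram.transpose_le_iff, le_iff_rowLen_le]
  simp only [YoungDiagram.rowLen_transpose]

theorem ext_colLen {ν κ : YoungDiagram} (h : ∀ k, ν.colLen k = κ.colLen k) : ν = κ :=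
  le_antisymm (le_iff_colLen_le.2 fun k => (h k).le) (le_iff_colLen_le.2 fun k => (h k).ge)

theorem card_eq_sum_rowLen (ν : YoungDiagram) {K : ℕ} (hK : ν.colLen 0 ≤ K) :
    ν.card = ∑ k ∈ Finset.range K, ν.rowLen k := by
  have hmap : ∀ c ∈ ν.cells, c.1 ∈ Finset.range K := by
    rintro ⟨i, j⟩ hc
    have h1 : i < ν.colLen j := YoungDiagram.mem_iff_lt_colLen.1 hc
    have h2 := ν.colLen_anti 0 j (Nat.zero_le _)
    simp only [Finset.mem_range]
    omega
  rw [YoungDiagram.card, Finset.card_eq_sum_card_fiberwise hmap]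
  refine Finset.sum_congr rfl fun k _ => ?_
  rw [YoungDiagram.rowLen_eq_card]
  rfl

theorem card_transpose (ν : YoungDiagram) : ν.transpose.card = ν.card := by
  simp [YoungDiagram.card, YoungDiagram.transpose]

theorem card_eq_sum_colLen (ν : YoungDiagram) {K : ℕ} (hK : ν.rowLen 0 ≤ K) :
    ν.card = ∑ k ∈ Finset.range K, ν.colLen k := by
  rw [← card_transpose, card_eq_sum_rowLen ν.transpose (K := K) (by
    rwa [YoungDiagram.colLen_transpose])]
  simp only [YoungDiagram.rowLen_transpose]

theorem rowLen_zero_le_card (ν : YoungDiagram) : ν.rowLen 0 ≤ ν.card := by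
  rw [YoungDiagram.rowLen_eq_card]
  exact Finset.card_filter_le _ _

theorem colLen_zero_le_card (ν : YoungDiagram) : ν.colLen 0 ≤ ν.card := by
  rw [YoungDiagram.colLen_eq_card]
  exact Finset.card_filter_le _ _

theorem card_eq_zero_iff {ν : YoungDiagram} : ν.card = 0 ↔ ν = ⊥ := by
  constructor
  · intro h
    exact YoungDiagram.ext (Finset.card_eq_zero.1 h)
  · rintro rfl
    rfl

theorem eq_of_le_of_card_eq {ν κ : YoungDiagram} (h : ν ≤ κ) (hc : ν.card = κ.card) : ν = κ :=
  YoungDiagram.ext (Finset.eq_of_subset_of_card_le h hc.ge)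

theorem rowLen_bot (k : ℕ) : (⊥ : YoungDiagram).rowLen k = 0 := by
  by_contra h
  have : (k, 0) ∈ (⊥ : YoungDiagram) := YoungDiagram.mem_iff_lt_rowLen.2 (Nat.pos_of_ne_zero h)
  exact YoungDiagram.notMem_bot _ this

theorem colLen_bot (k : ℕ) : (⊥ : YoungDiagram).colLen k = 0 := by
  by_contra h
  have : (0, k) ∈ (⊥ : YoungDiagram) := YoungDiagram.mem_iff_lt_colLen.2 (Nat.pos_of_ne_zero h)
  exact YoungDiagram.notMem_bot _ this

theorem card_bot : (⊥ : YoungDiagram).card = 0 := rfl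

/-- A skew diagram is a horizontal strip exactly when the row lengths interlace. -/
theorem isHorizontalStrip_iff {ν κ : YoungDiagram} {m : ℕ} :
    IsHorizontalStrip ν κ m ↔
      ν ≤ κ ∧ κ.card = ν.card + m ∧ ∀ k, κ.rowLen (k + 1) ≤ ν.rowLen k := by
  unfold IsHorizontalStrip
  refine and_congr_right fun hle => and_congr ?_ ⟨?_, ?_⟩
  · have h1 := Finset.card_sdiff_of_subset (YoungDiagram.cells_subset_iff.2 hle)
    have h2 := Finset.card_le_card (YoungDiagram.cells_subset_iff.2 hle)
    simp only [YoungDiagram.card]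
    omega
  · intro h k
    by_contra hc
    rw [not_le] at hc
    have h2 := κ.rowLen_anti k (k + 1) (Nat.le_succ k)
    have h3 := ν.rowLen_anti k (k + 1) (Nat.le_succ k)
    have := Finset.card_le_one.1 (h (ν.rowLen k)) (k, ν.rowLen k) (by
      simp only [Finset.mem_filter, Finset.mem_sdiff, YoungDiagram.mem_cells,
        YoungDiagram.mem_iff_lt_rowLen, and_true]; omega) (k + 1, ν.rowLen k) (by
      simp only [Finset.mem_filter, Finset.mem_sdiff, YoungDiagram.mem_cells,
        YoungDiagram.mem_iff_lt_rowLen, and_true]; omega)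
    simp at this
  · intro h j
    have key : ∀ a b : ℕ, a < b → j < κ.rowLen b → j < ν.rowLen a := fun a b hab hb =>
      hb.trans_le ((κ.rowLen_anti (a + 1) b hab).trans (h a))
    refine Finset.card_le_one.2 ?_
    rintro ⟨a, j1⟩ ha ⟨b, j2⟩ hb
    simp only [Finset.mem_filter, Finset.mem_sdiff, YoungDiagram.mem_cells,
        YoungDiagram.mem_iff_lt_rowLen] at ha hb
    obtain ⟨ha, rfl⟩ := ha
    obtain ⟨hb, rfl⟩ := hb
    rcases lt_trichotomy a b with hab | rfl | hab
    · exact absurd (key a b hab hb.1) ha.2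
    · rfl
    · exact absurd (key b a hab ha.1) hb.2

theorem IsHorizontalStrip.colLen_le {ν κ : YoungDiagram} {m : ℕ} (h : IsHorizontalStrip ν κ m)
    (i : ℕ) : κ.colLen i ≤ ν.colLen i + 1 := by
  by_contra hc
  have h1 := (lt_colLen_iff κ (i := ν.colLen i + 1) (k := i)).1 (by omega)
  have h2 := (isHorizontalStrip_iff.1 h).2.2 (ν.colLen i)
  have h3 := (lt_colLen_iff ν (i := ν.colLen i) (k := i)).2 (by omega)
  omega

/-- A weakly decreasing vector is the vector of column lengths of a Young diagram. -/
theorem exists_colLen_eq {N : ℕ} {f : Fin N → ℕ} (hf : Antitone f) :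
    ∃ κ : YoungDiagram, κ.rowLen 0 ≤ N ∧ ∀ i : Fin N, κ.colLen i = f i := by
  let w : List ℕ := List.ofFn f
  have hw : w.SortedGE := List.sortedGE_ofFn_iff.2 hf
  have hlen : w.length = N := List.length_ofFn
  refine ⟨(YoungDiagram.ofRowLens w hw).transpose, ?_, fun i => ?_⟩
  · rw [YoungDiagram.rowLen_transpose]
    by_contra hc
    have : (N, 0) ∈ YoungDiagram.ofRowLens w hw :=
      YoungDiagram.mem_iff_lt_colLen.2 (not_le.1 hc)
    rw [YoungDiagram.mem_ofRowLens] at this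
    obtain ⟨h, -⟩ := this
    omega
  · rw [YoungDiagram.colLen_transpose]
    have := YoungDiagram.rowLen_ofRowLens (hw := hw) ⟨i, by omega⟩
    simp only at this
    rw [this]
    simp [w]

/-- The first `N` column lengths of a diagram. -/
def colVec (N : ℕ) (ν : YoungDiagram) : Fin N → ℕ :=
  fun i => ν.colLen i

theorem colVec_antitone (N : ℕ) (ν : YoungDiagram) : Antitone (colVec N ν) :=
  fun _ _ h => ν.colLen_anti _ _ h

theorem partsVec_eq_colVec (N : ℕ) (ν : YoungDiagram) : partsVec N ν = colVec N ν.transpose := by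
  funext i
  simp [partsVec, colVec]

theorem sum_colVec {N : ℕ} {ν : YoungDiagram} (h : ν.rowLen 0 ≤ N) :
    ∑ i, colVec N ν i = ν.card := by
  rw [card_eq_sum_colLen ν h, ← Fin.sum_univ_eq_sum_range]
  rfl

theorem colVec_bot (N : ℕ) : colVec N ⊥ = 0 := by
  funext i
  exact colLen_bot i

theorem card_colVec_eq_succ {N : ℕ} {ν : YoungDiagram} (h : ν.rowLen 0 ≤ N) (k : ℕ) :
    (Finset.univ.filter fun i => colVec N ν i = k + 1).card = ν.rowLen k - ν.rowLen (k + 1) := by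
  have h1 := ν.rowLen_anti 0 k (Nat.zero_le _)
  rw [← card_block (N := N) (s := ν.rowLen (k + 1)) (m := ν.rowLen k - ν.rowLen (k + 1)) (by
    have := ν.rowLen_anti k (k + 1) (Nat.le_succ k)
    omega)]
  congr 1
  ext i
  have h2 := lt_colLen_iff ν (i := k) (k := i)
  have h3 := lt_colLen_iff ν (i := k + 1) (k := i)
  simp only [Finset.mem_filter, Finset.mem_univ, true_and, mem_block]
  simp only [colVec]
  omega

theorem colVec_injOn {N : ℕ} {ν κ : YoungDiagram} (hν : ν.rowLen 0 ≤ N) (hκ : κ.rowLen 0 ≤ N)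
    (h : colVec N ν = colVec N κ) : ν = κ := by
  refine ext_colLen fun k => ?_
  rcases Nat.lt_or_ge k N with hk | hk
  · exact congrFun h ⟨k, hk⟩
  · rw [colLen_eq_zero (hν.trans hk), colLen_eq_zero (hκ.trans hk)]

open Classical in
/-- The diagrams with rows of length at most `N` obtained from `ν` by adding a horizontal strip of
length `r`. -/
def stripsAbove (N : ℕ) (ν : YoungDiagram) (r : ℕ) : Finset YoungDiagram :=
  (youngDiagramsOfCard (ν.card + r)).filter fun κ => IsHorizontalStrip ν κ r ∧ κ.rowLen 0 ≤ N

theorem mem_stripsAbove {N r : ℕ} {ν κ : YoungDiagram} :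
    κ ∈ stripsAbove N ν r ↔ IsHorizontalStrip ν κ r ∧ κ.rowLen 0 ≤ N := by
  simp only [stripsAbove, Finset.mem_filter, mem_youngDiagramsOfCard, and_iff_right_iff_imp]
  exact fun h => (isHorizontalStrip_iff.1 h.1).2.1

end Young

/-! ### The Pieri rule for straightening functions -/

section Pieri

/-- The coefficient of the Pieri rule attached to the horizontal strip `κ / ν`. -/
def stripWeight {A : Type*} [CommRing A] (q : A) (ν κ : YoungDiagram) : A :=
  ∏ k ∈ Finset.range (κ.colLen 0),
    gaussBinom q (κ.rowLen k - κ.rowLen (k + 1)) (κ.rowLen k - ν.rowLen k)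

theorem map_stripWeight {A B : Type*} [CommRing A] [CommRing B] (f : A →+* B) (q : A)
    (ν κ : YoungDiagram) : f (stripWeight q ν κ) = stripWeight (f q) ν κ := by
  simp [stripWeight, map_gaussBinom]

theorem stripWeight_eq_prod_range {A : Type*} [CommRing A] (q : A) (ν κ : YoungDiagram) {K : ℕ}
    (hK : κ.colLen 0 ≤ K) :
    stripWeight q ν κ = ∏ k ∈ Finset.range K,
      gaussBinom q (κ.rowLen k - κ.rowLen (k + 1)) (κ.rowLen k - ν.rowLen k) := by
  refine Finset.prod_subset (Finset.range_mono hK) fun k _ hk => ?_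
  rw [rowLen_eq_zero (ν := κ) (k := k) (by simpa using hk)]
  simp

/-- The normalising factor `∏_k [m_k]!` of an exponent vector, where `m_k` is the number of entries
equal to `k`. -/
def blockNorm {A : Type*} [CommRing A] (q : A) {N : ℕ} (l : Fin N → ℕ) : A :=
  ∏ k ∈ Finset.univ.image l, gaussFact q (Finset.univ.filter fun i => l i = k).card

theorem blockNorm_eq_prod_range {A : Type*} [CommRing A] (q : A) {N : ℕ} (l : Fin N → ℕ) {K : ℕ}
    (hK : ∀ i, l i < K) :
    blockNorm q l =
      ∏ k ∈ Finset.range K, gaussFact q (Finset.univ.filter fun i => l i = k).card := by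
  refine Finset.prod_subset (fun k hk => ?_) fun k _ hk => ?_
  · obtain ⟨i, -, rfl⟩ := Finset.mem_image.1 hk
    exact Finset.mem_range.2 (hK i)
  · rw [Finset.card_eq_zero.2, gaussFact_zero]
    rw [Finset.filter_eq_empty_iff]
    exact fun i _ h => hk (Finset.mem_image.2 ⟨i, Finset.mem_univ _, h⟩)

variable {A : Type*} [Field A] {q : A}

/-- Passing from the multiplicities `m_k` of a partition to the multiplicities `M_k` after raising
`r_k` of the entries equal to `k`, the Gaussian binomials change from `[m_k choose r_k]` to
`[M_{k+1} choose r_k]`. -/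
theorem prod_gaussBinom_mul_prod_gaussFact (hq : ∀ m, gaussFact q m ≠ 0) {m r M : ℕ → ℕ} {K : ℕ}
    (hr : ∀ k, r k ≤ m k) (hmK : m K = 0) (hM0 : M 0 = m 0 - r 0)
    (hM : ∀ k, M (k + 1) = m (k + 1) - r (k + 1) + r k) :
    (∏ k ∈ Finset.range K, gaussBinom q (m k) (r k)) *
        ∏ k ∈ Finset.range (K + 1), gaussFact q (M k) =
      (∏ k ∈ Finset.range K, gaussBinom q (M (k + 1)) (r k)) *
        ∏ k ∈ Finset.range K, gaussFact q (m k) := by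
  have e1 : ∀ k, gaussBinom q (m k) (r k) =
      gaussFact q (m k) / (gaussFact q (r k) * gaussFact q (m k - r k)) := fun k => by
    rw [eq_div_iff (mul_ne_zero (hq _) (hq _)), gaussBinom_mul_gaussFact q (hr k)]
  have e2 : ∀ k, gaussBinom q (M (k + 1)) (r k) = gaussFact q (M (k + 1)) /
      (gaussFact q (r k) * gaussFact q (m (k + 1) - r (k + 1))) := fun k => by
    rw [eq_div_iff (mul_ne_zero (hq _) (hq _)),
      ← gaussBinom_mul_gaussFact q (m := M (k + 1)) (k := r k) (by rw [hM]; omega), hM,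
      Nat.add_sub_cancel]
  have e3 : (∏ k ∈ Finset.range K, gaussFact q (m k - r k)) =
      gaussFact q (M 0) * ∏ k ∈ Finset.range K, gaussFact q (m (k + 1) - r (k + 1)) := by
    have h1 := Finset.prod_range_succ (fun k => gaussFact q (m k - r k)) K
    rw [Finset.prod_range_succ', hmK, Nat.zero_sub, gaussFact_zero, mul_one] at h1
    rw [← h1, hM0, mul_comm]
  have n1 : (∏ k ∈ Finset.range K, gaussFact q (r k)) ≠ 0 :=
    Finset.prod_ne_zero_iff.2 fun k _ => hq _
  have n2 : (∏ k ∈ Finset.range K, gaussFact q (m (k + 1) - r (k + 1))) ≠ 0 :=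
    Finset.prod_ne_zero_iff.2 fun k _ => hq _
  have n3 := hq (M 0)
  simp only [e1, e2, Finset.prod_div_distrib, Finset.prod_mul_distrib, Finset.prod_range_succ', e3]
  field_simp

theorem blockNorm_ne_zero (hq : ∀ m, gaussFact q m ≠ 0) {N : ℕ} (l : Fin N → ℕ) :
    blockNorm q l ≠ 0 :=
  Finset.prod_ne_zero_iff.2 fun _ _ => hq _

theorem colVec_eq_add_zeroOne {N r : ℕ} {ν κ : YoungDiagram} (h : IsHorizontalStrip ν κ r) :
    colVec N κ = colVec N ν +
      zeroOne (Finset.univ.filter fun i : Fin N => ν.colLen i < κ.colLen i) := by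
  funext i
  have h1 := h.colLen_le i
  have h2 := le_iff_colLen_le.1 h.1 i
  simp only [colVec, zeroOne, Pi.add_apply, Finset.mem_filter, Finset.mem_univ, true_and]
  split_ifs <;> omega

theorem flush_iff_antitone {N : ℕ} {l : Fin N → ℕ} (hl : Antitone l) {S : Finset (Fin N)} :
    Flush l S ↔ Antitone (l + zeroOne S) := by
  constructor
  · intro h i j hij
    have h1 := hl hij
    simp only [Pi.add_apply, zeroOne]
    rcases h1.lt_or_eq with h2 | h2
    · split_ifs <;> omega
    · by_cases hj : j ∈ S
      · simp [hj, h j hj i hij h2.symm, h2]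
      · simp [hj, h2]
  · intro h i hi j hj hij
    have h1 := h hj
    simp only [Pi.add_apply, zeroOne, hi, if_true, hij] at h1
    by_contra hc
    simp [hc] at h1

open Classical in
/-- **Pieri rule.** Let `F` straighten with parameter `q`. After division by the normalising factors
`blockNorm`, the sum of `F` over all ways to raise `r` entries of a partition runs over the
partitions differing by a strip, with the Gaussian coefficients `stripWeight`. -/
theorem Straightens.pieri {N : ℕ} {F : (Fin N → ℕ) → A} (hF : Straightens q F)
    (hq : ∀ m, gaussFact q m ≠ 0) {ν : YoungDiagram} (hν : ν.rowLen 0 ≤ N) (r : ℕ) :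
    (∑ S ∈ (Finset.univ : Finset (Fin N)).powersetCard r, F (colVec N ν + zeroOne S)) /
        blockNorm q (colVec N ν) =
      ∑ κ ∈ stripsAbove N ν r,
        stripWeight q ν κ * (F (colVec N κ) / blockNorm q (colVec N κ)) := by
  set l := colVec N ν with hl
  have hanti : Antitone l := colVec_antitone N ν
  set K := ν.colLen 0 + 1 with hK
  have hlK : ∀ i, l i < K := fun i => Nat.lt_succ_of_le (ν.colLen_anti 0 i (Nat.zero_le _))
  -- cutting `F` down to one degree preserves the straightening relation
  let F' : (Fin N → ℕ) → A := fun α => if ∑ i, α i = ∑ i, l i + r then F α else 0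
  have hF' : Straightens q F' := by
    intro α i j hij hα
    have h1 : ∀ x : Fin N, ∑ k, (α + Pi.single x 1 : Fin N → ℕ) k = ∑ k, α k + 1 := fun x => by
      simp [Finset.sum_add_distrib]
    simp only [F', h1]
    split_ifs
    · exact hF α i j hij hα
    · simp
  have hsize : ∀ S : Finset (Fin N), (∑ i, (l + zeroOne S) i = ∑ i, l i + r) ↔ S.card = r := by
    intro S
    simp only [Pi.add_apply, Finset.sum_add_distrib, sum_zeroOne]
    omega
  have main := hF'.sum_powerset_lt hanti K l (fun _ _ => rfl)
  have hall : (Finset.univ.filter fun i => l i < K) = Finset.univ :=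
    Finset.filter_true_of_mem fun i _ => hlK i
  rw [hall] at main
  have hL : ∑ S ∈ (Finset.univ : Finset (Fin N)).powersetCard r, F (l + zeroOne S) =
      ∑ S ∈ (Finset.univ : Finset (Fin N)).powerset, F' (l + zeroOne S) := by
    simp only [F', hsize, ← Finset.sum_filter]
    rw [← Finset.powersetCard_eq_filter]
  rw [hL, main, Finset.sum_div]
  have hR : ∑ S ∈ (Finset.univ : Finset (Fin N)).powerset.filter (Flush l),
      ((∏ k ∈ Finset.range K, gaussBinom q (Finset.univ.filter fun i => l i = k).card
        (S.filter fun i => l i = k).card) * F' (l + zeroOne S)) / blockNorm q l =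
      ∑ S ∈ (Finset.univ : Finset (Fin N)).powerset.filter (fun S => Flush l S ∧ S.card = r),
      ((∏ k ∈ Finset.range K, gaussBinom q (Finset.univ.filter fun i => l i = k).card
        (S.filter fun i => l i = k).card) * F (l + zeroOne S)) / blockNorm q l := by
    rw [← Finset.filter_filter, Finset.sum_filter (fun S : Finset (Fin N) => S.card = r)]
    refine Finset.sum_congr rfl fun S _ => ?_
    simp only [F', hsize]
    split_ifs <;> simp
  rw [hR]
  symm
  refine Finset.sum_bij
    (fun κ _ => Finset.univ.filter fun i : Fin N => ν.colLen i < κ.colLen i) ?_ ?_ ?_ ?_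
  · intro κ hκ
    obtain ⟨h1, h2⟩ := mem_stripsAbove.1 hκ
    have h3 := colVec_eq_add_zeroOne (N := N) h1
    simp only [Finset.mem_filter, Finset.powerset_univ, Finset.mem_univ, true_and]
    refine ⟨(flush_iff_antitone hanti).2 (h3 ▸ colVec_antitone N κ), (hsize _).1 ?_⟩
    rw [← h3, sum_colVec h2, hl, sum_colVec hν, (isHorizontalStrip_iff.1 h1).2.1]
  · intro κ hκ κ' hκ' heq
    obtain ⟨h1, h2⟩ := mem_stripsAbove.1 hκ
    obtain ⟨h1', h2'⟩ := mem_stripsAbove.1 hκ'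
    refine colVec_injOn h2 h2' ?_
    rw [colVec_eq_add_zeroOne h1, colVec_eq_add_zeroOne h1', heq]
  · intro S hS
    simp only [Finset.mem_filter, Finset.powerset_univ, Finset.mem_univ, true_and] at hS
    obtain ⟨κ, h1, h2⟩ := exists_colLen_eq ((flush_iff_antitone hanti).1 hS.1)
    have h3 : colVec N κ = l + zeroOne S := funext h2
    have h4 : ∀ k, ν.colLen k ≤ κ.colLen k ∧ κ.colLen k ≤ ν.colLen k + 1 := by
      intro k
      rcases Nat.lt_or_ge k N with hk | hk
      · have := h2 ⟨k, hk⟩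
        simp only [Pi.add_apply, zeroOne, hl, colVec] at this
        split_ifs at this <;> omega
      · rw [colLen_eq_zero (hν.trans hk), colLen_eq_zero (h1.trans hk)]
        omega
    have hcard : κ.card = ν.card + r := by
      rw [← sum_colVec h1, h3, ← sum_colVec hν]
      exact (hsize S).2 hS.2
    refine ⟨κ, mem_stripsAbove.2 ⟨isHorizontalStrip_iff.2
      ⟨le_iff_colLen_le.2 fun k => (h4 k).1, hcard, fun k => ?_⟩, h1⟩, ?_⟩
    · by_contra hc
      have h5 := (lt_colLen_iff κ (i := k + 1) (k := ν.rowLen k)).2 (not_le.1 hc)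
      have h6 := (lt_colLen_iff ν (i := k) (k := ν.rowLen k)).1 (by
        have := h4 (ν.rowLen k)
        omega)
      omega
    · ext i
      have := h2 i
      simp only [Pi.add_apply, zeroOne, hl, colVec] at this
      simp only [Finset.mem_filter, Finset.mem_univ, true_and]
      split_ifs at this with h <;> simp [h, this]
  · intro κ hκ
    obtain ⟨h1, h2⟩ := mem_stripsAbove.1 hκ
    have h3 := colVec_eq_add_zeroOne (N := N) h1
    set S := Finset.univ.filter fun i : Fin N => ν.colLen i < κ.colLen i with hS
    rw [← h3]
    have hcol : κ.colLen 0 ≤ K := h1.colLen_le 0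
    have hrS : ∀ k, (S.filter fun i => l i = k).card = κ.rowLen k - ν.rowLen k := by
      intro k
      have hle := le_iff_rowLen_le.1 h1.1 k
      have h0 := κ.rowLen_anti 0 k (Nat.zero_le _)
      rw [← card_block (N := N) (s := ν.rowLen k) (m := κ.rowLen k - ν.rowLen k) (by omega)]
      congr 1
      ext i
      have e1 := lt_colLen_iff ν (i := k) (k := i)
      have e2 := lt_colLen_iff κ (i := k) (k := i)
      have e3 := h1.colLen_le i
      simp only [hS, hl, Finset.mem_filter, Finset.mem_univ, true_and, mem_block]
      simp only [colVec]
      omega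
    have hzero : (Finset.univ.filter fun i => colVec N κ i = 0) =
        (Finset.univ.filter fun i => l i = 0) \ (S.filter fun i => l i = 0) := by
      ext i
      have e4 := le_iff_colLen_le.1 h1.1 i
      simp only [hS, hl, Finset.mem_filter, Finset.mem_univ, true_and, Finset.mem_sdiff]
      simp only [colVec]
      omega
    have hsucc : ∀ k, (Finset.univ.filter fun i => colVec N κ i = k + 1) =
        ((Finset.univ.filter fun i => l i = k + 1) \ (S.filter fun i => l i = k + 1)) ∪
          (S.filter fun i => l i = k) := by
      intro k
      ext i
      have e3 := h1.colLen_le i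
      have e4 := le_iff_colLen_le.1 h1.1 i
      simp only [hS, hl, Finset.mem_filter, Finset.mem_univ, true_and, Finset.mem_sdiff,
        Finset.mem_union]
      simp only [colVec]
      omega
    have hsub : ∀ k, (S.filter fun i => l i = k) ⊆ Finset.univ.filter fun i => l i = k :=
      fun k => Finset.filter_subset_filter _ (Finset.subset_univ _)
    have alg := prod_gaussBinom_mul_prod_gaussFact hq (K := K)
      (m := fun k => (Finset.univ.filter fun i => l i = k).card)
      (r := fun k => (S.filter fun i => l i = k).card)
      (M := fun k => (Finset.univ.filter fun i => colVec N κ i = k).card)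
      (fun k => Finset.card_le_card (hsub k))
      (Finset.card_eq_zero.2 (Finset.filter_eq_empty_iff.2 fun i _ => (hlK i).ne))
      (by simp only [hzero, Finset.card_sdiff_of_subset (hsub 0)])
      (fun k => by
        simp only [hsucc]
        rw [Finset.card_union_of_disjoint, Finset.card_sdiff_of_subset (hsub (k + 1))]
        rw [Finset.disjoint_left]
        intro i hi hi'
        simp only [Finset.mem_sdiff, Finset.mem_filter, Finset.mem_univ, true_and] at hi hi'
        omega)
    rw [← blockNorm_eq_prod_range q l hlK, ← blockNorm_eq_prod_range q (colVec N κ) (fun i =>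
      Nat.lt_succ_of_le ((κ.colLen_anti 0 i (Nat.zero_le _)).trans hcol))] at alg
    have hw : stripWeight q ν κ = ∏ k ∈ Finset.range K,
        gaussBinom q (Finset.univ.filter fun i => colVec N κ i = k + 1).card
          (S.filter fun i => l i = k).card := by
      rw [stripWeight_eq_prod_range q ν κ hcol]
      refine Finset.prod_congr rfl fun k _ => ?_
      rw [card_colVec_eq_succ h2, hrS]
    rw [hw, ← mul_div_assoc, div_eq_div_iff (blockNorm_ne_zero hq _) (blockNorm_ne_zero hq _)]
    linear_combination (-F (colVec N κ)) * alg

end Pieri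

/-! ### Sums over permutations and multiplication by elementary symmetric functions -/

section PermSum

variable {N : ℕ} {A : Type*}

/-- The `r`-th elementary symmetric function of the elements `y_i`. -/
def elemSym [CommRing A] (y : Fin N → A) (r : ℕ) : A :=
  ∑ S ∈ (Finset.univ : Finset (Fin N)).powersetCard r, ∏ i ∈ S, y i

theorem elemSym_zero [CommRing A] (y : Fin N → A) : elemSym y 0 = 1 := by
  simp [elemSym]

theorem elemSym_perm [CommRing A] (y : Fin N → A) (r : ℕ) (w : Equiv.Perm (Fin N)) :
    elemSym (fun i => y (w i)) r = elemSym y r := by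
  unfold elemSym
  conv_rhs => rw [← Finset.map_univ_equiv w, Finset.powersetCard_map, Finset.sum_map]
  refine Finset.sum_congr rfl fun S _ => ?_
  simp

/-- The sum `∑_w g(w) w(y^α)` over all permutations of the `y_i`. -/
def permSum [CommRing A] (g : Equiv.Perm (Fin N) → A) (y : Fin N → A) (α : Fin N → ℕ) : A :=
  ∑ w : Equiv.Perm (Fin N), g w * ∏ i, y (w i) ^ α i

theorem elemSym_mul_permSum [CommRing A] (g : Equiv.Perm (Fin N) → A) (y : Fin N → A) (r : ℕ)
    (α : Fin N → ℕ) :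
    elemSym y r * permSum g y α =
      ∑ S ∈ (Finset.univ : Finset (Fin N)).powersetCard r, permSum g y (α + zeroOne S) := by
  unfold permSum
  rw [Finset.mul_sum, Finset.sum_comm]
  refine Finset.sum_congr rfl fun w _ => ?_
  rw [← elemSym_perm y r w, elemSym, Finset.sum_mul]
  refine Finset.sum_congr rfl fun S _ => ?_
  have : ∏ i, y (w i) ^ (α + zeroOne S) i = (∏ i, y (w i) ^ α i) * ∏ i ∈ S, y (w i) := by
    simp only [Pi.add_apply, pow_add, Finset.prod_mul_distrib, zeroOne]
    congr 1
    simp [Finset.prod_ite_mem, pow_ite]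
  rw [this]
  ring

end PermSum

/-! ### The Hall–Littlewood kernel -/

section Kernel

variable {N : ℕ} {A : Type*} [Field A]

/-- The factor `∏_{i<j} (z_i - q z_j) / (z_i - z_j)`. -/
def hlKernel (q : A) (z : Fin N → A) : A :=
  ∏ i, ∏ j ∈ Finset.Ioi i, (z i - q * z j) / (z i - z j)

/-- In a product over all pairs `a < b`, swapping two adjacent variables changes only the factor
belonging to them. -/
theorem prod_Ioi_swap {R : Type*} [CommRing R] (f : Fin N → Fin N → R) {i j : Fin N}
    (hij : (i : ℕ) + 1 = j) :
    ∃ c, ∏ a, ∏ b ∈ Finset.Ioi a, f a b = c * f i j ∧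
      ∏ a, ∏ b ∈ Finset.Ioi a, f (Equiv.swap i j a) (Equiv.swap i j b) = c * f j i := by
  have hpairs : ∀ h : Fin N → Fin N → R, ∏ a, ∏ b ∈ Finset.Ioi a, h a b =
      ∏ p ∈ (Finset.univ : Finset (Fin N × Fin N)).filter fun p => p.1 < p.2, h p.1 p.2 := by
    intro h
    rw [Finset.prod_filter, ← Finset.univ_product_univ, Finset.prod_product]
    refine Finset.prod_congr rfl fun a _ => ?_
    rw [← Finset.prod_filter]
    refine Finset.prod_congr ?_ fun _ _ => rfl
    ext b
    simp
  have hmem : (i, j) ∈ (Finset.univ : Finset (Fin N × Fin N)).filter fun p => p.1 < p.2 := by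
    simp only [Finset.mem_filter, Finset.mem_univ, true_and, Fin.lt_def]
    omega
  refine ⟨∏ p ∈ ((Finset.univ : Finset (Fin N × Fin N)).filter fun p => p.1 < p.2).erase (i, j),
    f p.1 p.2, ?_, ?_⟩
  · rw [hpairs, Finset.prod_erase_mul _ _ hmem]
  · rw [hpairs, ← Finset.prod_erase_mul _ _ hmem]
    simp only [Equiv.swap_apply_left, Equiv.swap_apply_right]
    congr 1
    have hmaps : ∀ p ∈ ((Finset.univ : Finset (Fin N × Fin N)).filter
        fun p => p.1 < p.2).erase (i, j),
        (Equiv.swap i j p.1, Equiv.swap i j p.2) ∈ ((Finset.univ : Finset (Fin N × Fin N)).filter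
          fun p => p.1 < p.2).erase (i, j) := by
      rintro ⟨a, b⟩ hp
      simp only [Finset.mem_erase, Finset.mem_filter, Finset.mem_univ, true_and, ne_eq,
        Prod.mk.injEq, Fin.lt_def, Fin.ext_iff, Equiv.swap_apply_def] at hp ⊢
      split_ifs <;> omega
    exact Finset.prod_nbij' (fun p => (Equiv.swap i j p.1, Equiv.swap i j p.2))
      (fun p => (Equiv.swap i j p.1, Equiv.swap i j p.2)) hmaps hmaps
      (fun p _ => by simp) (fun p _ => by simp) (fun p _ => rfl)

/-- The Hall–Littlewood symmetrization straightens with parameter `q`. With `u = z_i`, `v = z_{i+1}`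
this is the antisymmetry of `(u - q v) (v - q u) / (u - v)`. -/
theorem straightens_hlKernel (q : A) {y : Fin N → A} (hy : Function.Injective y) :
    Straightens q (permSum (fun w => hlKernel q fun i => y (w i)) y) := by
  intro α i j hij hα
  have hne : i ≠ j := by rintro rfl; omega
  rw [← sub_eq_zero]
  unfold permSum
  rw [Finset.mul_sum, ← Finset.sum_sub_distrib]
  have hprod : ∀ (w : Equiv.Perm (Fin N)) (x : Fin N),
      ∏ k, y (w k) ^ (α + Pi.single x 1 : Fin N → ℕ) k = (∏ k, y (w k) ^ α k) * y (w x) := by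
    intro w x
    simp only [Pi.add_apply, pow_add, Finset.prod_mul_distrib, Pi.single_apply]
    simp [pow_ite]
  simp only [hprod]
  refine Finset.sum_involution (fun w _ => w * Equiv.swap i j) ?_ ?_ ?_ ?_
  · intro w _
    obtain ⟨c, h1, h2⟩ := prod_Ioi_swap
      (fun a b => (y (w a) - q * y (w b)) / (y (w a) - y (w b))) hij
    have h1' : hlKernel q (fun k => y (w k)) = _ := h1
    have h2' : hlKernel q (fun k => y ((w * Equiv.swap i j) k)) = _ := h2
    have h3 : ∏ k, y ((w * Equiv.swap i j) k) ^ α k = ∏ k, y (w k) ^ α k := by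
      rw [← Equiv.prod_comp (Equiv.swap i j) fun k => y (w k) ^ α k]
      refine Finset.prod_congr rfl fun k _ => ?_
      rw [Equiv.Perm.mul_apply]
      congr 1
      rw [Equiv.swap_apply_def]
      split_ifs with h h'
      · rw [h, hα]
      · rw [h', hα]
      · rfl
    rw [h1', h2', h3]
    simp only [Equiv.Perm.mul_apply, Equiv.swap_apply_left, Equiv.swap_apply_right]
    have huv : y (w i) - y (w j) ≠ 0 := sub_ne_zero.2 fun h => hne (w.injective (hy h))
    have hvu : y (w j) - y (w i) ≠ 0 := sub_ne_zero.2 fun h => hne (w.injective (hy h)).symm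
    rw [show y (w j) - y (w i) = -(y (w i) - y (w j)) by ring]
    field_simp
    ring
  · intro w _ _ h
    have h1 : (w * Equiv.swap i j) i = w i := by rw [h]
    rw [Equiv.Perm.mul_apply, Equiv.swap_apply_left] at h1
    exact hne (w.injective h1).symm
  · intro w _
    exact Finset.mem_univ _
  · intro w _
    rw [mul_assoc, Equiv.swap_mul_self, mul_one]

/-- The one-variable case of the symmetrization identity, by Lagrange interpolation of the
polynomial `(∏_k (z - q y_k) - q^n ∏_k (z - y_k)) / z` at the points `y_k`. -/
theorem sum_prod_div_eq_geom_sum {q : A} (hq : q ≠ 1) {n : ℕ} {y : Fin n → A}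
    (hy : Function.Injective y) (hy0 : ∀ i, y i ≠ 0) :
    ∑ p, ∏ k ∈ Finset.univ.erase p, (y p - q * y k) / (y p - y k) =
      ∑ j ∈ Finset.range n, q ^ j := by
  rcases Nat.eq_zero_or_pos n with rfl | hn
  · simp
  have h1q : (1 - q) ≠ 0 := sub_ne_zero.2 (Ne.symm hq)
  let P1 : A[X] := ∏ k : Fin n, (X - C (q * y k))
  let P2 : A[X] := ∏ k : Fin n, (X - C (y k))
  let P : A[X] := P1 - C (q ^ n) * P2
  have hm1 : P1.Monic := monic_prod_of_monic _ _ fun k _ => monic_X_sub_C _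
  have hm2 : P2.Monic := monic_prod_of_monic _ _ fun k _ => monic_X_sub_C _
  have hd1 : P1.natDegree = n := by
    simp only [P1]
    rw [natDegree_prod_of_monic _ _ fun k _ => monic_X_sub_C _]
    simp only [natDegree_X_sub_C, Finset.sum_const, Finset.card_univ, Fintype.card_fin,
      smul_eq_mul, mul_one]
  have hd2 : P2.natDegree = n := by simp [P2]
  have hP0 : P.coeff 0 = 0 := by
    simp only [P, P1, P2, coeff_zero_eq_eval_zero, eval_sub, eval_mul, eval_C, eval_prod, eval_X]
    simp only [zero_sub, ← mul_neg, Finset.prod_mul_distrib, Finset.prod_const, Finset.card_univ,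
      Fintype.card_fin, sub_self]
  have hPX : P.divX * X = P := by
    have := divX_mul_X_add P
    rwa [hP0, C_0, add_zero] at this
  have hPdeg : P.natDegree ≤ n := by
    refine (natDegree_sub_le _ _).trans (max_le hd1.le ?_)
    exact (natDegree_C_mul_le _ _).trans hd2.le
  have hdeg : P.divX.degree < (Finset.univ : Finset (Fin n)).card := by
    rw [Finset.card_univ, Fintype.card_fin]
    refine lt_of_le_of_lt degree_le_natDegree ?_
    rw [natDegree_divX_eq_natDegree_tsub_one]
    exact_mod_cast (by omega : P.natDegree - 1 < n)
  have hcoef : P.divX.coeff (n - 1) = 1 - q ^ n := by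
    rw [coeff_divX, Nat.sub_add_cancel hn]
    simp only [P, coeff_sub, coeff_C_mul]
    have e1 : P1.coeff n = 1 := by
      conv_lhs => rw [← hd1]
      exact hm1.coeff_natDegree
    have e2 : P2.coeff n = 1 := by
      conv_lhs => rw [← hd2]
      exact hm2.coeff_natDegree
    rw [e1, e2, mul_one]
  have heval : ∀ p, P.divX.eval (y p) =
      (1 - q) * ∏ k ∈ Finset.univ.erase p, (y p - q * y k) := by
    intro p
    have h1 : P.divX.eval (y p) * y p = P.eval (y p) := by
      conv_rhs => rw [← hPX]
      rw [eval_mul, eval_X]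
    have h2 : P.eval (y p) = ∏ k, (y p - q * y k) := by
      have h3 : ∏ k, (y p - y k) = 0 := Finset.prod_eq_zero (Finset.mem_univ p) (sub_self _)
      simp only [P, P1, P2, eval_sub, eval_mul, eval_C, eval_prod, eval_X, h3, mul_zero, sub_zero]
    rw [h2, ← Finset.mul_prod_erase _ _ (Finset.mem_univ p)] at h1
    apply mul_right_cancel₀ (hy0 p)
    rw [h1]
    ring
  have main := Lagrange.coeff_eq_sum (s := Finset.univ) (v := y) hy.injOn hdeg
  rw [Finset.card_univ, Fintype.card_fin, hcoef] at main
  apply mul_left_cancel₀ h1q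
  rw [mul_neg_geom_sum, main, Finset.mul_sum]
  refine Finset.sum_congr rfl fun p _ => ?_
  rw [heval, Finset.prod_div_distrib, mul_div_assoc]

/-- The symmetrization of the kernel itself is the `q`-factorial. The induction sums first over the
permutations with a given value at `0`. -/
theorem sum_hlKernel_perm {q : A} (hq : q ≠ 1) :
    ∀ {n : ℕ} {y : Fin n → A}, Function.Injective y → (∀ i, y i ≠ 0) →
      ∑ w : Equiv.Perm (Fin n), hlKernel q (fun i => y (w i)) = gaussFact q n := by
  intro n
  induction n with
  | zero => intro y _ _; simp [hlKernel]
  | succ n ih =>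
    intro y hy hy0
    have hsplit : ∀ z : Fin (n + 1) → A, hlKernel q z =
        (∏ j : Fin n, (z 0 - q * z j.succ) / (z 0 - z j.succ)) * hlKernel q fun j => z j.succ := by
      intro z
      unfold hlKernel
      rw [Fin.prod_univ_succ, Fin.prod_Ioi_zero]
      simp only [Fin.prod_Ioi_succ]
    rw [← Equiv.sum_comp Equiv.Perm.decomposeFin.symm, Fintype.sum_prod_type]
    have hp : ∀ p : Fin (n + 1), ∑ e : Equiv.Perm (Fin n),
        hlKernel q (fun i => y (Equiv.Perm.decomposeFin.symm (p, e) i)) =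
        (∏ k ∈ Finset.univ.erase p, (y p - q * y k) / (y p - y k)) * gaussFact q n := by
      intro p
      have hinj : Function.Injective fun j : Fin n => y (Equiv.swap 0 p j.succ) := fun a b h =>
        Fin.succ_injective _ ((Equiv.swap 0 p).injective (hy h))
      rw [← ih hinj fun i => hy0 _, Finset.mul_sum]
      refine Finset.sum_congr rfl fun e _ => ?_
      rw [hsplit]
      simp only [Equiv.Perm.decomposeFin_symm_apply_zero, Equiv.Perm.decomposeFin_symm_apply_succ]
      congr 1
      rw [Equiv.prod_comp e fun j => (y p - q * y (Equiv.swap 0 p j.succ)) /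
        (y p - y (Equiv.swap 0 p j.succ))]
      symm
      refine Finset.prod_bij' (i := fun k _ => Equiv.swap 0 p k)
        (j := fun k _ => Equiv.swap 0 p k)
        (s := Finset.univ.erase p) (t := Finset.univ.erase 0)
        (g := fun k => (y p - q * y (Equiv.swap 0 p k)) / (y p - y (Equiv.swap 0 p k)))
        ?_ ?_ ?_ ?_ ?_ |>.trans ?_
      · intro k hk
        simp only [Finset.mem_erase, Finset.mem_univ, and_true] at hk ⊢
        intro h
        rw [Equiv.swap_apply_eq_iff, Equiv.swap_apply_left] at h
        exact hk h
      · intro k hk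
        simp only [Finset.mem_erase, Finset.mem_univ, and_true] at hk ⊢
        intro h
        rw [Equiv.swap_apply_eq_iff, Equiv.swap_apply_right] at h
        exact hk h
      · intro k _; simp
      · intro k _; simp
      · intro k _; simp
      · have : (Finset.univ : Finset (Fin (n + 1))).erase 0 =
            Finset.univ.map (Fin.succEmb n) := by
          ext k
          simp only [Finset.mem_erase, Finset.mem_univ, and_true, Finset.mem_map, true_and,
            Fin.coe_succEmb]
          exact ⟨fun h => ⟨k.pred h, Fin.succ_pred k h⟩, fun ⟨j, hj⟩ => hj ▸ Fin.succ_ne_zero j⟩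
        rw [this, Finset.prod_map]
        rfl
    rw [Finset.sum_congr rfl fun p _ => hp p, ← Finset.sum_mul, sum_prod_div_eq_geom_sum hq hy hy0,
      gaussFact_succ, mul_comm]

end Kernel

/-! ### Alternants -/

section Alternant

variable {N : ℕ}

/-- The alternant `det (y_i ^ α_j)` over a commutative ring. -/
def alternantAt {R : Type*} [CommRing R] (y : Fin N → R) (α : Fin N → ℕ) : R :=
  Matrix.det (Matrix.of fun i j : Fin N => y i ^ α j)

/-- The exponent vector `δ = (N-1, …, 1, 0)`. -/
def staircase (N : ℕ) : Fin N → ℕ :=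
  fun j => N - 1 - (j : ℕ)

theorem alternantAt_eq_permSum {R : Type*} [CommRing R] (y : Fin N → R) (α : Fin N → ℕ) :
    alternantAt y α = permSum (fun w => ((Equiv.Perm.sign w : ℤ) : R)) y α := by
  rw [alternantAt, Matrix.det_apply']
  rfl

theorem map_alternantAt {R S : Type*} [CommRing R] [CommRing S] (f : R →+* S) (y : Fin N → R)
    (α : Fin N → ℕ) : f (alternantAt y α) = alternantAt (fun i => f (y i)) α := by
  rw [alternantAt, RingHom.map_det]
  congr 1
  ext i j
  simp

theorem alternantAt_staircase_ne_zero {A : Type*} [CommRing A] [IsDomain A] {y : Fin N → A}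
    (hy : Function.Injective y) : alternantAt y (staircase N) ≠ 0 := by
  have h1 := Matrix.det_vandermonde_ne_zero_iff.2 hy
  have h2 : Matrix.of (fun i j : Fin N => y i ^ staircase N j) =
      (Matrix.vandermonde y).submatrix id Fin.revPerm := by
    ext i j
    simp only [Matrix.of_apply, staircase, Matrix.submatrix_apply, id_eq, Fin.revPerm_apply,
      Matrix.vandermonde_apply, Fin.val_rev]
    congr 1
    omega
  rw [alternantAt, h2, Matrix.det_permute']
  refine mul_ne_zero ?_ h1
  rcases Int.units_eq_one_or (Equiv.Perm.sign (Fin.revPerm : Equiv.Perm (Fin N))) with h | h <;>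
    simp [h]

theorem elemSym_mul_alternantAt {R : Type*} [CommRing R] (y : Fin N → R) (r : ℕ)
    (α β : Fin N → ℕ) :
    elemSym y r * alternantAt y (α + β) =
      ∑ S ∈ (Finset.univ : Finset (Fin N)).powersetCard r,
        alternantAt y ((α + zeroOne S) + β) := by
  rw [alternantAt_eq_permSum, elemSym_mul_permSum]
  refine Finset.sum_congr rfl fun S _ => ?_
  rw [alternantAt_eq_permSum, add_right_comm]

/-- Ratios of alternants straighten with parameter `0`: raising the right one of two equal adjacent
parts makes two exponents of the shifted alternant equal. -/
theorem straightens_alternantAt {R : Type*} [Field R] (y : Fin N → R) :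
    Straightens 0 fun α => alternantAt y (α + staircase N) / alternantAt y (staircase N) := by
  intro α i j hij hα
  have hne : i ≠ j := by rintro rfl; omega
  have hj := j.isLt
  have : alternantAt y (α + Pi.single j 1 + staircase N) = 0 := by
    refine Matrix.det_zero_of_column_eq hne fun k => ?_
    simp only [Matrix.of_apply, Pi.add_apply, staircase, Pi.single_eq_same,
      Pi.single_eq_of_ne hne, hα]
    congr 1
    omega
  simp [this]

end Alternant

/-! ### Weighted sums over chains of horizontal strips -/

section StripSum

theorem finite_stripsBelow (κ : YoungDiagram) (m : ℕ) :
    {ν : YoungDiagram | IsHorizontalStrip ν κ m}.Finite :=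
  (finite_youngDiagrams_le κ).subset fun _ h => h.1

/-- The diagrams obtained from `κ` by removing a horizontal strip of length `m`. -/
def stripsBelow (κ : YoungDiagram) (m : ℕ) : Finset YoungDiagram :=
  (finite_stripsBelow κ m).toFinset

theorem mem_stripsBelow {κ ν : YoungDiagram} {m : ℕ} :
    ν ∈ stripsBelow κ m ↔ IsHorizontalStrip ν κ m := by
  simp [stripsBelow]

open Classical in
/-- The sum over all chains of horizontal strips of lengths `c` from `∅` to `κ` of the product of
the weights `W` of the strips, as a recursion that removes the last strip. -/
def stripSum {A : Type*} [CommRing A] (W : YoungDiagram → YoungDiagram → A) :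
    (n : ℕ) → (Fin n → ℕ) → YoungDiagram → A
  | 0, _, κ => if κ = ⊥ then 1 else 0
  | n + 1, c, κ => ∑ ν ∈ stripsBelow κ (c (Fin.last n)),
      stripSum W n (fun i => c i.castSucc) ν * W ν κ

variable {A : Type*} [CommRing A] {W : YoungDiagram → YoungDiagram → A}

theorem stripSum_succ {n : ℕ} (c : Fin (n + 1) → ℕ) (κ : YoungDiagram) :
    stripSum W (n + 1) c κ = ∑ ν ∈ stripsBelow κ (c (Fin.last n)),
      stripSum W n (fun i => c i.castSucc) ν * W ν κ :=
  rfl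

theorem map_stripSum {B : Type*} [CommRing B] (f : A →+* B) (n : ℕ) :
    ∀ (c : Fin n → ℕ) (κ : YoungDiagram),
      f (stripSum W n c κ) = stripSum (fun ν κ => f (W ν κ)) n c κ := by
  induction n with
  | zero => intro c κ; simp only [stripSum]; split_ifs <;> simp
  | succ n ih => intro c κ; simp [stripSum_succ, ih]

open Classical in
/-- Iterating a Pieri rule `e r * G ν = ∑ W ν κ * G κ` expands a product of the `e r`. -/
theorem prod_mul_eq_sum_stripSum {N : ℕ} {e : ℕ → A} {G : YoungDiagram → A}
    (h : ∀ ν r, ν.rowLen 0 ≤ N → e r * G ν = ∑ κ ∈ stripsAbove N ν r, W ν κ * G κ) (n : ℕ) :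
    ∀ c : Fin n → ℕ, (∏ a, e (c a)) * G ⊥ =
      ∑ κ ∈ (youngDiagramsOfCard (∑ a, c a)).filter fun κ => κ.rowLen 0 ≤ N,
        stripSum W n c κ * G κ := by
  induction n with
  | zero =>
    intro c
    have : (youngDiagramsOfCard (∑ a, c a)).filter (fun κ => κ.rowLen 0 ≤ N) = {⊥} := by
      ext κ
      simp only [Finset.univ_eq_empty, Finset.sum_empty, Finset.mem_filter,
        mem_youngDiagramsOfCard, card_eq_zero_iff, Finset.mem_singleton, and_iff_left_iff_imp]
      rintro rfl
      rw [rowLen_bot]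
      exact Nat.zero_le _
    rw [this]
    simp [stripSum]
  | succ n ih =>
    intro c
    rw [Fin.prod_univ_castSucc, mul_assoc, mul_comm (e _), ← mul_assoc,
      ih fun i => c i.castSucc, Finset.sum_mul]
    have h1 : ∀ ν ∈ (youngDiagramsOfCard (∑ a : Fin n, c a.castSucc)).filter
        (fun κ => κ.rowLen 0 ≤ N),
        stripSum W n (fun i => c i.castSucc) ν * G ν * e (c (Fin.last n)) =
        ∑ κ ∈ stripsAbove N ν (c (Fin.last n)),
          stripSum W n (fun i => c i.castSucc) ν * W ν κ * G κ := by
      intro ν hν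
      rw [mul_assoc, mul_comm (G ν), h ν _ (Finset.mem_filter.1 hν).2, Finset.mul_sum]
      exact Finset.sum_congr rfl fun κ _ => (mul_assoc _ _ _).symm
    rw [Finset.sum_congr rfl h1]
    simp only [stripSum_succ, Finset.sum_mul]
    refine Finset.sum_comm' fun ν κ => ?_
    simp only [Finset.mem_filter, mem_youngDiagramsOfCard, mem_stripsAbove, mem_stripsBelow,
      Fin.sum_univ_castSucc]
    constructor
    · rintro ⟨⟨h1, h2⟩, h3, h4⟩
      exact ⟨h3, by rw [(isHorizontalStrip_iff.1 h3).2.1, h1], h4⟩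
    · rintro ⟨h3, h1, h4⟩
      have h5 := (isHorizontalStrip_iff.1 h3).2.1
      exact ⟨⟨by omega, (le_iff_rowLen_le.1 h3.1 0).trans h4⟩, h3, h4⟩

theorem stripSum_eq_sum_stripChains (n : ℕ) : ∀ (c : Fin n → ℕ) (κ : YoungDiagram),
    stripSum W n c κ = ∑ ν ∈ stripChains c κ, ∏ a : Fin n, W (ν a.castSucc) (ν a.succ) := by
  induction n with
  | zero =>
    intro c κ
    simp only [stripSum]
    split_ifs with h
    · have : stripChains c κ = {fun _ => ⊥} := by
        ext ν
        simp only [mem_stripChains, IsStripChain, h, Finset.mem_singleton]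
        constructor
        · rintro ⟨h1, -, -⟩
          funext i
          rw [Fin.fin_one_eq_zero i, h1]
        · rintro rfl
          exact ⟨rfl, rfl, fun a => a.elim0⟩
      rw [this]
      simp
    · have : stripChains c κ = ∅ := by
        ext ν
        simp only [mem_stripChains, IsStripChain, Finset.notMem_empty, iff_false]
        rintro ⟨h1, h2, -⟩
        exact h (h2 ▸ h1)
      rw [this]
      simp
  | succ n ih =>
    intro c κ
    rw [stripSum_succ]
    simp only [ih, Finset.sum_mul]
    rw [Finset.sum_sigma']
    refine Finset.sum_bij' (i := fun p _ => Fin.snoc (α := fun _ => YoungDiagram) p.2 κ)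
      (j := fun ν _ => ⟨ν (Fin.last n).castSucc, fun i => ν i.castSucc⟩) ?_ ?_ ?_ ?_ ?_
    · rintro ⟨α, ν⟩ hp
      simp only [Finset.mem_sigma, mem_stripsBelow, mem_stripChains, IsStripChain] at hp ⊢
      obtain ⟨h0, h1, h2, h3⟩ := hp
      refine ⟨?_, ?_, ?_⟩
      · rw [← h1, ← Fin.castSucc_zero, Fin.snoc_castSucc]
      · rw [Fin.snoc_last]
      · intro a
        refine Fin.lastCases ?_ (fun a => ?_) a
        · rw [Fin.snoc_castSucc, Fin.succ_last, Fin.snoc_last, h2]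
          exact h0
        · rw [Fin.snoc_castSucc, Fin.succ_castSucc, Fin.snoc_castSucc]
          exact h3 a
    · intro ν hν
      simp only [Finset.mem_sigma, mem_stripsBelow, mem_stripChains, IsStripChain] at hν ⊢
      obtain ⟨h1, h2, h3⟩ := hν
      refine ⟨?_, by rw [Fin.castSucc_zero, h1], trivial, fun a => ?_⟩
      · have := h3 (Fin.last n)
        rwa [Fin.succ_last, h2] at this
      · have := h3 a.castSucc
        rwa [Fin.succ_castSucc] at this
    · rintro ⟨α, ν⟩ hp
      simp only [Finset.mem_sigma, mem_stripChains, IsStripChain] at hp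
      obtain ⟨-, -, rfl, -⟩ := hp
      simp
    · intro ν hν
      rw [mem_stripChains] at hν
      funext i
      refine Fin.lastCases ?_ (fun i => ?_) i
      · rw [Fin.snoc_last, hν.2.1]
      · rw [Fin.snoc_castSucc]
    · rintro ⟨α, ν⟩ hp
      simp only [Finset.mem_sigma, mem_stripChains, IsStripChain] at hp
      rw [Fin.prod_univ_castSucc]
      simp only [Fin.succ_castSucc, Fin.snoc_castSucc, Fin.succ_last, Fin.snoc_last, hp.2.2.1]

/-- The sum `∑_i (n - i) κ_i` of the first `n` partial sums of the row lengths; it is strictly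
increasing in the dominance order on diagrams with at most `n` rows. -/
def dominanceRank (n : ℕ) (κ : YoungDiagram) : ℕ :=
  ∑ i : Fin n, (n - i) * κ.rowLen i

/-- Triangularity of `stripSum`: the shape of a chain dominates its content, with dominance measured
by `dominanceRank`. -/
theorem stripSum_triangular (n : ℕ) : ∀ (c : Fin n → ℕ) (κ : YoungDiagram), stripSum W n c κ ≠ 0 →
    κ.colLen 0 ≤ n ∧ κ.card = ∑ i, c i ∧ ∑ i : Fin n, (n - (i : ℕ)) * c i ≤ dominanceRank n κ ∧
      (∑ i : Fin n, (n - (i : ℕ)) * c i = dominanceRank n κ → ∀ i : Fin n, c i = κ.rowLen i) := by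
  induction n with
  | zero =>
    intro c κ h
    simp only [stripSum, ne_eq, ite_eq_right_iff, Classical.not_imp] at h
    rw [h.1, colLen_bot]
    simp [card_bot]
  | succ n ih =>
    intro c κ h
    rw [stripSum_succ] at h
    obtain ⟨ν, hν, h1⟩ := Finset.exists_ne_zero_of_sum_ne_zero h
    obtain ⟨i1, i2, i3, i4⟩ := ih _ _ (left_ne_zero_of_mul h1)
    have hs := mem_stripsBelow.1 hν
    obtain ⟨s1, s2, s3⟩ := isHorizontalStrip_iff.1 hs
    have hrow : κ.colLen 0 ≤ n + 1 := (hs.colLen_le 0).trans (by omega)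
    have hcard : κ.card = ∑ i, c i := by rw [s2, i2, Fin.sum_univ_castSucc]
    have hsum : ∀ d : Fin (n + 1) → ℕ, ∑ i : Fin (n + 1), (n + 1 - (i : ℕ)) * d i =
        ∑ i : Fin n, (n - (i : ℕ)) * d i.castSucc + ∑ i, d i := by
      intro d
      rw [Fin.sum_univ_castSucc, Fin.sum_univ_castSucc d, ← add_assoc, ← Finset.sum_add_distrib]
      congr 1
      · refine Finset.sum_congr rfl fun i _ => ?_
        have := i.isLt
        rw [Fin.val_castSucc, show n + 1 - (i : ℕ) = (n - i) + 1 by omega]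
        ring
      · simp
    have hκ : dominanceRank (n + 1) κ = dominanceRank n κ + κ.card := by
      rw [dominanceRank, hsum fun i => κ.rowLen i, card_eq_sum_rowLen κ hrow,
        Fin.sum_univ_eq_sum_range]
      rfl
    have hmono : dominanceRank n ν ≤ dominanceRank n κ :=
      Finset.sum_le_sum fun i _ => Nat.mul_le_mul le_rfl (le_iff_rowLen_le.1 s1 _)
    refine ⟨hrow, hcard, ?_, fun heq => ?_⟩
    · rw [hsum, hκ, ← hcard]
      omega
    · rw [hsum, hκ, ← hcard] at heq
      have e1 := i4 (by omega)
      have e2 : dominanceRank n ν = dominanceRank n κ := by omega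
      have e3 := (Finset.sum_eq_sum_iff_of_le fun i _ =>
        Nat.mul_le_mul le_rfl (le_iff_rowLen_le.1 s1 _)).1 e2
      have e4 : ∀ i : Fin n, c i.castSucc = κ.rowLen i := by
        intro i
        have := e3 i (Finset.mem_univ i)
        have hi := i.isLt
        rw [e1 i]
        exact Nat.eq_of_mul_eq_mul_left (by omega) this
      intro i
      refine Fin.lastCases ?_ (fun i => ?_) i
      · have h2 := card_eq_sum_rowLen κ hrow
        rw [hcard, Fin.sum_univ_castSucc, ← Fin.sum_univ_eq_sum_range, Fin.sum_univ_castSucc,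
          Finset.sum_congr rfl fun i _ => e4 i] at h2
        exact Nat.add_left_cancel h2
      · exact e4 i

/-- When shape and content agree, the only chain consists of the initial rows of the shape. -/
theorem stripSum_diagonal
    (hW : ∀ n ν κ, κ.colLen 0 ≤ n + 1 → ν.colLen 0 ≤ n → (∀ i < n, ν.rowLen i = κ.rowLen i) →
      W ν κ = 1) (n : ℕ) :
    ∀ (c : Fin n → ℕ) (κ : YoungDiagram), κ.colLen 0 ≤ n → (∀ i : Fin n, c i = κ.rowLen i) →
      stripSum W n c κ = 1 := by
  induction n with
  | zero =>
    intro c κ h _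
    rw [stripSum, if_pos]
    rw [← card_eq_zero_iff, card_eq_sum_rowLen κ h]
    simp
  | succ n ih =>
    intro c κ h hc
    obtain ⟨ρ, h1, h2⟩ := exists_colLen_eq (f := fun i : Fin n => κ.rowLen i)
      fun i j hij => κ.rowLen_anti _ _ hij
    -- the first `n` rows of `κ`
    set τ := ρ.transpose with hτ
    have t1 : τ.colLen 0 ≤ n := by rw [hτ, YoungDiagram.colLen_transpose]; exact h1
    have t2 : ∀ i < n, τ.rowLen i = κ.rowLen i := fun i hi => by
      rw [hτ, YoungDiagram.rowLen_transpose]; exact h2 ⟨i, hi⟩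
    have hle : τ ≤ κ := le_iff_rowLen_le.2 fun k => by
      rcases Nat.lt_or_ge k n with hk | hk
      · exact (t2 k hk).le
      · rw [rowLen_eq_zero (t1.trans hk)]; exact Nat.zero_le _
    have hcard : κ.card = τ.card + κ.rowLen n := by
      rw [card_eq_sum_rowLen κ h, card_eq_sum_rowLen τ t1, Finset.sum_range_succ,
        Finset.sum_congr rfl fun i hi => t2 i (Finset.mem_range.1 hi)]
    have hlast : c (Fin.last n) = κ.rowLen n := hc _
    have hstrip : IsHorizontalStrip τ κ (c (Fin.last n)) := by
      refine isHorizontalStrip_iff.2 ⟨hle, by rw [hcard, hlast], fun k => ?_⟩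
      rcases Nat.lt_or_ge k n with hk | hk
      · rw [t2 k hk]; exact κ.rowLen_anti _ _ (Nat.le_succ k)
      · rw [rowLen_eq_zero (ν := κ) (by omega)]; exact Nat.zero_le _
    rw [stripSum_succ, Finset.sum_eq_single τ]
    · rw [ih _ τ t1 fun i => by rw [t2 i i.isLt]; exact hc i.castSucc, hW n τ κ h t1 t2, one_mul]
    · intro ν hν hne
      by_contra h0
      obtain ⟨i1, i2, -, -⟩ := stripSum_triangular n _ _ (left_ne_zero_of_mul h0)
      obtain ⟨s1, s2, s3⟩ := isHorizontalStrip_iff.1 (mem_stripsBelow.1 hν)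
      refine hne (eq_of_le_of_card_eq (le_iff_rowLen_le.2 fun k => ?_) (by omega))
      rcases Nat.lt_or_ge k n with hk | hk
      · rw [t2 k hk]; exact le_iff_rowLen_le.1 s1 k
      · rw [rowLen_eq_zero (i1.trans hk)]; exact Nat.zero_le _
    · intro hn
      exact absurd (mem_stripsBelow.2 hstrip) hn

theorem stripWeight_initial_rows (q : A) {n : ℕ} {ν κ : YoungDiagram} (hκ : κ.colLen 0 ≤ n + 1)
    (hν : ν.colLen 0 ≤ n) (h : ∀ i < n, ν.rowLen i = κ.rowLen i) : stripWeight q ν κ = 1 := by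
  rw [stripWeight_eq_prod_range q ν κ hκ]
  refine Finset.prod_eq_one fun k hk => ?_
  rcases Nat.lt_or_ge k n with hk' | hk'
  · rw [h k hk', Nat.sub_self, gaussBinom_zero_right]
  · rw [rowLen_eq_zero (ν := κ) (k := k + 1) (by omega), rowLen_eq_zero (hν.trans hk')]
    simp

theorem stripWeight_zero {ν κ : YoungDiagram} {m : ℕ} (h : IsHorizontalStrip ν κ m) :
    stripWeight (0 : A) ν κ = 1 :=
  Finset.prod_eq_one fun k _ => by
    have h1 := (isHorizontalStrip_iff.1 h).2.2 k
    exact gaussBinom_zero_left (by omega)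

/-- The weighted chain sum of the Gaussian coefficients is the right-hand side of the chain
formula. The factor of the first strip, which the product leaves out, is `1`. -/
theorem algebraMap_stripSum_eq (n : ℕ) (c : Fin n → ℕ) (κ : YoungDiagram) :
    algebraMap ℤ[X] (FractionRing ℤ[X]) (stripSum (stripWeight X) n c κ) =
      ∑ ν ∈ stripChains c κ,
        ∏ a ∈ Finset.univ.filter (fun a : Fin n => 1 ≤ (a : ℕ)),
          ∏ i ∈ Finset.range (κ.colLen 0),
            qBinom (((ν a.succ).rowLen i : ℤ) - ((ν a.succ).rowLen (i + 1) : ℤ))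
              (((ν a.castSucc).rowLen i : ℤ) - ((ν a.succ).rowLen (i + 1) : ℤ)) := by
  rw [stripSum_eq_sum_stripChains, map_sum]
  refine Finset.sum_congr rfl fun ν hν => ?_
  obtain ⟨h0, h1, h2⟩ := mem_stripChains.1 hν
  have hmono : Monotone ν := Fin.monotone_iff_le_succ.2 fun i => (h2 i).1
  rw [map_prod]
  symm
  refine Finset.prod_subset_one_on_sdiff (Finset.subset_univ _) ?_ ?_
  · intro a ha
    have ha0 : a.castSucc = 0 := by
      simp only [Finset.mem_sdiff, Finset.mem_filter, Finset.mem_univ, true_and] at ha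
      ext
      simp only [Fin.val_castSucc, Fin.coe_ofNat_eq_mod, Nat.zero_mod]
      omega
    have h3 := (isHorizontalStrip_iff.1 (h2 a)).2.2 0
    rw [ha0, h0, rowLen_bot] at h3
    have hcol : (ν a.succ).colLen 0 ≤ 1 := by
      have := lt_colLen_iff (ν a.succ) (i := 1) (k := 0)
      rw [zero_add] at h3
      omega
    rw [ha0, h0, stripWeight_initial_rows X (n := 0) hcol (by rw [colLen_bot]) (by simp), map_one]
  · intro a _
    have hle : ν a.succ ≤ κ := h1 ▸ hmono (Fin.le_last _)
    rw [stripWeight_eq_prod_range X _ _ (le_iff_colLen_le.1 hle 0), map_prod]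
    refine Finset.prod_congr rfl fun i _ => ?_
    have e1 := (isHorizontalStrip_iff.1 (h2 a)).2.2 i
    have e2 := le_iff_rowLen_le.1 (h2 a).1 i
    rw [← qBinom_eq (by omega)]
    congr 1 <;> omega

end StripSum

/-! ### Unitriangular changes of family -/

section Unitriangular

variable {ι R V : Type*} [Fintype ι] [CommRing R] [AddCommGroup V] [Module R V]

/-- A finite family from which a second one arises by a unitriangular change lies in the span of the
second. -/
theorem mem_span_range_of_unitriangular {M : ι → ι → R} {B E : ι → V} (rank : ι → ℕ)
    (hdiag : ∀ i, M i i = 1) (htri : ∀ i j, M i j ≠ 0 → i ≠ j → rank i < rank j)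
    (hE : ∀ i, E i = ∑ j, M i j • B j) (i : ι) : B i ∈ Submodule.span R (Set.range E) := by
  classical
  obtain ⟨b, hb⟩ : ∃ b, ∀ i, rank i ≤ b :=
    ⟨Finset.univ.sup rank, fun i => Finset.le_sup (Finset.mem_univ i)⟩
  have key : ∀ d i, b - rank i ≤ d → B i ∈ Submodule.span R (Set.range E) := by
    intro d
    induction d with
    | zero =>
      intro i hi
      have : E i = B i := by
        rw [hE, Finset.sum_eq_single i]
        · rw [hdiag, one_smul]
        · intro j _ hj
          by_contra h
          have h1 := htri i j (fun h0 => h (by rw [h0, zero_smul])) hj.symm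
          have := hb j
          omega
        · simp
      exact this ▸ Submodule.subset_span ⟨i, rfl⟩
    | succ d ih =>
      intro i hi
      have : B i = E i - ∑ j ∈ Finset.univ.erase i, M i j • B j := by
        rw [hE, ← Finset.add_sum_erase _ _ (Finset.mem_univ i), hdiag, one_smul]
        abel
      rw [this]
      refine Submodule.sub_mem _ (Submodule.subset_span ⟨i, rfl⟩)
        (Submodule.sum_mem _ fun j hj => ?_)
      by_cases h0 : M i j = 0
      · rw [h0, zero_smul]; exact Submodule.zero_mem _
      · have h1 := htri i j h0 (Finset.ne_of_mem_erase hj).symm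
        have := hb j
        exact Submodule.smul_mem _ _ (ih j (by omega))
  exact key _ i le_rfl

/-- If a finite linearly independent family is expressed through a family of the same size lying in
its span, then the second family is linearly independent as well. -/
theorem linearIndependent_of_mutual_span {M : ι → ι → R} {B E : ι → V}
    (hlin : LinearIndependent R E) (hE : ∀ i, E i = ∑ j, M i j • B j)
    (hB : ∀ i, B i ∈ Submodule.span R (Set.range E)) : LinearIndependent R B := by
  classical
  choose L hL using fun i => (Submodule.mem_span_range_iff_exists_fun R).1 (hB i)
  have hML : Matrix.of M * Matrix.of L = 1 := by
    ext i k
    have h1 : ∑ k, ((Matrix.of M * Matrix.of L) i k) • E k =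
        ∑ k, ((1 : Matrix ι ι R) i k) • E k := by
      simp only [Matrix.one_apply, ite_smul, one_smul, zero_smul, Finset.sum_ite_eq,
        Finset.mem_univ, if_true]
      conv_rhs => rw [hE]
      simp only [← hL, Finset.smul_sum, Matrix.mul_apply, Matrix.of_apply,
        Finset.sum_smul, smul_smul]
      exact Finset.sum_comm
    have h2 := Fintype.linearIndependent_iff.1 hlin
      (fun k => (Matrix.of M * Matrix.of L) i k - (1 : Matrix ι ι R) i k) (by
        simp only [sub_smul, Finset.sum_sub_distrib]
        exact sub_eq_zero.2 h1) k
    exact sub_eq_zero.1 h2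
  have hLM : Matrix.of L * Matrix.of M = 1 := mul_eq_one_comm.1 hML
  refine Fintype.linearIndependent_iff.2 fun g hg => ?_
  have h1 : ∑ k, (Matrix.vecMul g (Matrix.of L)) k • E k = 0 := by
    rw [← hg]
    simp only [← hL, Finset.smul_sum, Matrix.vecMul, dotProduct, Matrix.of_apply, Finset.sum_smul,
      smul_smul]
    exact Finset.sum_comm
  have h2 : Matrix.vecMul g (Matrix.of L) = 0 := funext (Fintype.linearIndependent_iff.1 hlin _ h1)
  have h3 : g = 0 := by
    rw [← Matrix.vecMul_one g, ← hLM, ← Matrix.vecMul_vecMul, h2, Matrix.zero_vecMul]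
  exact fun i => congrFun h3 i

end Unitriangular

/-! ### Expansion of products of elementary symmetric functions -/

section Expansion

variable {N : ℕ}

theorem constQ_eq_algebraMap (p : ℤ[X]) : constQ N p = algebraMap ℤ[X] (RatFunField N) p := by
  rw [IsScalarTower.algebraMap_apply ℤ[X] (MvPolynomial (Fin N) ℤ[X]) (RatFunField N)]
  rfl

theorem algebraMap_ratFunField_injective :
    Function.Injective (algebraMap ℤ[X] (RatFunField N)) := by
  intro a b h
  rw [← constQ_eq_algebraMap, ← constQ_eq_algebraMap] at h
  exact MvPolynomial.C_injective _ _ (IsFractionRing.injective _ _ h)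

theorem varX_injective : Function.Injective (varX : Fin N → RatFunField N) := fun _ _ h =>
  MvPolynomial.X_injective (IsFractionRing.injective _ _ h)

theorem varX_ne_zero (i : Fin N) : (varX i : RatFunField N) ≠ 0 := fun h =>
  MvPolynomial.X_ne_zero i (IsFractionRing.injective (MvPolynomial (Fin N) ℤ[X]) (RatFunField N)
    (h.trans (map_zero _).symm))

theorem gaussFact_constQ_ne_zero (m : ℕ) : gaussFact (constQ N X) m ≠ 0 := by
  rw [constQ_eq_algebraMap, ← map_gaussFact]
  exact fun h => gaussFact_X_ne_zero m (algebraMap_ratFunField_injective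
    (h.trans (map_zero _).symm))

theorem constQ_X_ne_one : constQ N X ≠ 1 := by
  rw [constQ_eq_algebraMap]
  exact fun h => by
    have := congrArg (eval (0 : ℤ)) (algebraMap_ratFunField_injective (h.trans (map_one _).symm))
    simp at this

theorem hallLittlewoodP_eq (l : Fin N → ℕ) :
    hallLittlewoodP l =
      permSum (fun w => hlKernel (constQ N X) fun i => varX (w i)) varX l /
        blockNorm (constQ N X) l := by
  rw [hallLittlewoodP, div_eq_inv_mul]
  congr 2
  · simp only [constQ_eq_algebraMap, map_prod, hallLittlewoodV_eq, map_gaussFact]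
    rfl
  · funext w
    rw [mul_comm]
    rfl

theorem hallLittlewoodP_zero : hallLittlewoodP (0 : Fin N → ℕ) = 1 := by
  rw [hallLittlewoodP_eq, blockNorm_eq_prod_range (K := 1) _ _ (fun i => by simp), permSum]
  simp only [Pi.zero_apply, pow_zero, Finset.prod_const_one, mul_one]
  rw [sum_hlKernel_perm constQ_X_ne_one varX_injective varX_ne_zero]
  simp [gaussFact_constQ_ne_zero]

theorem schurPoly_eq (l : Fin N → ℕ) : schurPoly l =
    alternantAt varX (l + staircase N) / alternantAt varX (staircase N) :=
  rfl

theorem alternantAt_varX_staircase_ne_zero :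
    alternantAt (varX : Fin N → RatFunField N) (staircase N) ≠ 0 :=
  alternantAt_staircase_ne_zero varX_injective

theorem schurPoly_zero : schurPoly (0 : Fin N → ℕ) = 1 := by
  rw [schurPoly_eq, zero_add, div_self alternantAt_varX_staircase_ne_zero]

/-- The Pieri rule for Hall–Littlewood polynomials. -/
theorem elemSym_mul_hallLittlewoodP {ν : YoungDiagram} (hν : ν.rowLen 0 ≤ N) (r : ℕ) :
    elemSym varX r * hallLittlewoodP (colVec N ν) =
      ∑ κ ∈ stripsAbove N ν r, algebraMap ℤ[X] (RatFunField N) (stripWeight X ν κ) *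
        hallLittlewoodP (colVec N κ) := by
  simp only [hallLittlewoodP_eq, map_stripWeight, ← constQ_eq_algebraMap]
  rw [← (straightens_hlKernel (constQ N X) varX_injective).pieri gaussFact_constQ_ne_zero hν r,
    ← mul_div_assoc, elemSym_mul_permSum]

/-- The Pieri rule for Schur polynomials, which is the case `q = 0` of the general rule. -/
theorem elemSym_mul_schurPoly {ν : YoungDiagram} (hν : ν.rowLen 0 ≤ N) (r : ℕ) :
    elemSym varX r * schurPoly (colVec N ν) =
      ∑ κ ∈ stripsAbove N ν r, 1 * schurPoly (colVec N κ) := by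
  have h := (straightens_alternantAt (varX : Fin N → RatFunField N)).pieri
    (fun m => by rw [gaussFact_zero_left]; exact one_ne_zero) hν r
  have hb : ∀ l : Fin N → ℕ, blockNorm (0 : RatFunField N) l = 1 := fun l =>
    Finset.prod_eq_one fun _ _ => gaussFact_zero_left _
  simp only [hb, div_one] at h
  rw [schurPoly_eq, ← mul_div_assoc, elemSym_mul_alternantAt, Finset.sum_div, h]
  refine Finset.sum_congr rfl fun κ hκ => ?_
  rw [stripWeight_zero (mem_stripsAbove.1 hκ).1]
  rfl

theorem filter_rowLen_le_card (m : ℕ) (h : m ≤ N) :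
    ((youngDiagramsOfCard m).filter fun κ => κ.rowLen 0 ≤ N) = youngDiagramsOfCard m :=
  Finset.filter_true_of_mem fun κ hκ =>
    (rowLen_zero_le_card κ).trans ((mem_youngDiagramsOfCard.1 hκ).le.trans h)

theorem prod_elemSym_eq_sum_hallLittlewoodP {n : ℕ} (c : Fin n → ℕ) (hc : ∑ a, c a = N) :
    ∏ a, elemSym (varX : Fin N → RatFunField N) (c a) =
      ∑ κ ∈ youngDiagramsOfCard N,
        stripSum (stripWeight (X : ℤ[X])) n c κ • hallLittlewoodP (colVec N κ) := by
  classical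
  have h := prod_mul_eq_sum_stripSum (N := N) (e := elemSym (varX : Fin N → RatFunField N))
    (G := fun κ => hallLittlewoodP (colVec N κ))
    (W := fun ν κ => algebraMap ℤ[X] (RatFunField N) (stripWeight X ν κ))
    (fun ν r hν => elemSym_mul_hallLittlewoodP hν r) n c
  rw [colVec_bot, hallLittlewoodP_zero, mul_one] at h
  rw [h, hc]
  refine Finset.sum_congr ?_ fun κ _ => ?_
  · convert filter_rowLen_le_card N le_rfl
  · rw [Algebra.smul_def, map_stripSum]

theorem prod_elemSym_eq_sum_schurPoly {n : ℕ} (c : Fin n → ℕ) (hc : ∑ a, c a = N) :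
    ∏ a, elemSym (varX : Fin N → RatFunField N) (c a) =
      ∑ κ ∈ youngDiagramsOfCard N,
        stripSum (fun _ _ => (1 : ℤ[X])) n c κ • schurPoly (colVec N κ) := by
  classical
  have h := prod_mul_eq_sum_stripSum (N := N) (e := elemSym (varX : Fin N → RatFunField N))
    (G := fun κ => schurPoly (colVec N κ)) (W := fun ν κ => 1)
    (fun ν r hν => elemSym_mul_schurPoly hν r) n c
  rw [colVec_bot, schurPoly_zero, mul_one] at h
  rw [h, hc]
  refine Finset.sum_congr ?_ fun κ _ => ?_
  · convert filter_rowLen_le_card N le_rfl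
  · rw [Algebra.smul_def, map_stripSum, map_one]

end Expansion

/-! ### Bases of the symmetric polynomials of degree `N` -/

section Bases

variable {N : ℕ}

/-- The exponent of the `j`-th elementary symmetric function in `∏_i e_{κ_i}`. -/
def elemExponent (N : ℕ) (κ : YoungDiagram) : Fin N →₀ ℕ :=
  Finsupp.equivFunOnFinite.symm fun j : Fin N => κ.colLen j - κ.colLen (j + 1)

theorem elemExponent_injOn {κ κ' : YoungDiagram} (h : κ.card = N) (h' : κ'.card = N)
    (heq : elemExponent N κ = elemExponent N κ') : κ = κ' := by
  have hz : ∀ τ : YoungDiagram, τ.card = N → ∀ k, N ≤ k → τ.colLen k = 0 := fun τ hτ k hk =>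
    colLen_eq_zero ((rowLen_zero_le_card τ).trans (hτ.le.trans hk))
  have key : ∀ d k, N ≤ k + d → κ.colLen k = κ'.colLen k := by
    intro d
    induction d with
    | zero => intro k hk; rw [hz κ h k hk, hz κ' h' k hk]
    | succ d ih =>
      intro k hk
      rcases Nat.lt_or_ge k N with hkN | hkN
      · have h1 := DFunLike.congr_fun heq ⟨k, hkN⟩
        simp only [elemExponent, Finsupp.equivFunOnFinite_symm_apply_apply] at h1
        have h2 := ih (k + 1) (by omega)
        have h3 := κ.colLen_anti k (k + 1) (Nat.le_succ k)
        have h4 := κ'.colLen_anti k (k + 1) (Nat.le_succ k)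
        omega
      · rw [hz κ h k hkN, hz κ' h' k hkN]
  exact ext_colLen fun k => key N k (by omega)

theorem prod_elemSym_partsVec {A : Type*} [CommRing A] (y : Fin N → A) {κ : YoungDiagram}
    (h : κ.card = N) :
    ∏ i, elemSym y (partsVec N κ i) =
      ∏ j : Fin N, elemSym y (j + 1) ^ (elemExponent N κ j) := by
  have hrow : κ.transpose.rowLen 0 ≤ N := by
    rw [YoungDiagram.rowLen_transpose]; exact (colLen_zero_le_card κ).trans h.le
  have hmaps : ∀ i ∈ (Finset.univ : Finset (Fin N)), partsVec N κ i ∈ Finset.range (N + 1) := by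
    intro i _
    rw [Finset.mem_range, Nat.lt_succ_iff]
    exact (κ.rowLen_anti 0 i (Nat.zero_le _)).trans ((rowLen_zero_le_card κ).trans h.le)
  rw [← Finset.prod_fiberwise_of_maps_to hmaps, Finset.prod_range_succ']
  have h0 : ∏ i ∈ Finset.univ.filter (fun i => partsVec N κ i = 0),
      elemSym y (partsVec N κ i) = 1 :=
    Finset.prod_eq_one fun i hi => by rw [(Finset.mem_filter.1 hi).2, elemSym_zero]
  rw [h0, mul_one, Fin.prod_univ_eq_prod_range
    (fun j => ∏ i ∈ Finset.univ.filter (fun i => partsVec N κ i = j + 1),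
      elemSym y (partsVec N κ i)) N |>.symm]
  refine Finset.prod_congr rfl fun j _ => ?_
  rw [Finset.prod_congr rfl fun i hi => by rw [(Finset.mem_filter.1 hi).2], Finset.prod_const,
    partsVec_eq_colVec, card_colVec_eq_succ hrow]
  simp [elemExponent, YoungDiagram.rowLen_transpose]

/-- The products of elementary symmetric polynomials indexed by the partitions of `N` are linearly
independent, by the fundamental theorem on symmetric polynomials. -/
theorem linearIndependent_prod_elemSym :
    LinearIndependent ℤ[X] fun κ : {κ // κ ∈ youngDiagramsOfCard N} =>
      ∏ i, elemSym (varX : Fin N → RatFunField N) (partsVec N κ.1 i) := by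
  let φ : MvPolynomial (Fin N) ℤ[X] →ₐ[ℤ[X]] RatFunField N :=
    MvPolynomial.aeval fun j : Fin N => elemSym varX (j + 1)
  have hφ : Function.Injective φ := by
    have h1 := (MvPolynomial.esymmAlgHom_fin_bijective ℤ[X] N).1
    have h2 : φ = (((IsScalarTower.toAlgHom ℤ[X] (MvPolynomial (Fin N) ℤ[X])
        (RatFunField N)).comp (Subalgebra.val _)).comp
          (MvPolynomial.esymmAlgHom (Fin N) ℤ[X] N)) := by
      refine MvPolynomial.algHom_ext fun j => ?_
      change _ = algebraMap (MvPolynomial (Fin N) ℤ[X]) (RatFunField N)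
        (MvPolynomial.esymmAlgHom (Fin N) ℤ[X] N (MvPolynomial.X j)).val
      rw [MvPolynomial.esymmAlgHom_apply, MvPolynomial.aeval_X]
      simp [elemSym, varX, MvPolynomial.esymm]
    rw [h2]
    exact (IsFractionRing.injective (MvPolynomial (Fin N) ℤ[X]) (RatFunField N)).comp
      (Subtype.val_injective.comp h1)
  have hm : LinearIndependent ℤ[X] fun κ : {κ // κ ∈ youngDiagramsOfCard N} =>
      MvPolynomial.basisMonomials (Fin N) ℤ[X] (elemExponent N κ.1) :=
    (MvPolynomial.basisMonomials (Fin N) ℤ[X]).linearIndependent.comp _ fun κ κ' heq =>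
      Subtype.ext (elemExponent_injOn (mem_youngDiagramsOfCard.1 κ.2)
        (mem_youngDiagramsOfCard.1 κ'.2) heq)
  have hfun : (fun κ : {κ // κ ∈ youngDiagramsOfCard N} =>
      ∏ i, elemSym (varX : Fin N → RatFunField N) (partsVec N κ.1 i)) =
      φ.toLinearMap ∘ fun κ : {κ // κ ∈ youngDiagramsOfCard N} =>
        MvPolynomial.basisMonomials (Fin N) ℤ[X] (elemExponent N κ.1) := by
    funext κ
    rw [prod_elemSym_partsVec _ (mem_youngDiagramsOfCard.1 κ.2)]
    simp only [φ, Function.comp, MvPolynomial.coe_basisMonomials, AlgHom.toLinearMap_apply,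
      MvPolynomial.aeval_monomial, map_one, one_mul]
    rw [Finsupp.prod_fintype _ _ fun _ => pow_zero _]
  rw [hfun]
  exact hm.map' φ.toLinearMap (LinearMap.ker_eq_bot.2 hφ)

theorem sum_partsVec {κ : YoungDiagram} (h : κ.card = N) : ∑ i, partsVec N κ i = N := by
  rw [partsVec_eq_colVec, sum_colVec, card_transpose, h]
  rw [YoungDiagram.rowLen_transpose, ← h]
  exact colLen_zero_le_card κ

theorem stripSum_partsVec_diag {W : YoungDiagram → YoungDiagram → ℤ[X]}
    (hW : ∀ n ν κ, κ.colLen 0 ≤ n + 1 → ν.colLen 0 ≤ n → (∀ i < n, ν.rowLen i = κ.rowLen i) →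
      W ν κ = 1) (κ : {κ // κ ∈ youngDiagramsOfCard N}) :
    stripSum W N (partsVec N κ.1) κ.1 = 1 :=
  stripSum_diagonal hW N _ _
    ((colLen_zero_le_card _).trans (mem_youngDiagramsOfCard.1 κ.2).le) fun _ => rfl

theorem stripSum_partsVec_triangular {W : YoungDiagram → YoungDiagram → ℤ[X]}
    (κ κ' : {κ // κ ∈ youngDiagramsOfCard N}) (h : stripSum W N (partsVec N κ.1) κ'.1 ≠ 0)
    (hne : κ ≠ κ') : dominanceRank N κ.1 < dominanceRank N κ'.1 := by
  obtain ⟨h1, -, h3, h4⟩ := stripSum_triangular N _ _ h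
  refine lt_of_le_of_ne h3 fun heq => hne (Subtype.ext (ext_rowLen fun k => ?_))
  rcases Nat.lt_or_ge k N with hk | hk
  · exact h4 heq ⟨k, hk⟩
  · rw [rowLen_eq_zero (h1.trans hk), rowLen_eq_zero]
    exact (colLen_zero_le_card _).trans ((mem_youngDiagramsOfCard.1 κ.2).le.trans hk)

theorem prod_elemSym_eq_sum_subtype {W : YoungDiagram → YoungDiagram → ℤ[X]}
    {B : YoungDiagram → RatFunField N}
    (h : ∀ c : Fin N → ℕ, ∑ a, c a = N → ∏ a, elemSym (varX : Fin N → RatFunField N) (c a) =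
      ∑ κ ∈ youngDiagramsOfCard N, stripSum W N c κ • B κ)
    (κ : {κ // κ ∈ youngDiagramsOfCard N}) :
    ∏ i, elemSym (varX : Fin N → RatFunField N) (partsVec N κ.1 i) =
      ∑ κ' : {κ // κ ∈ youngDiagramsOfCard N}, stripSum W N (partsVec N κ.1) κ'.1 • B κ'.1 := by
  rw [h _ (sum_partsVec (mem_youngDiagramsOfCard.1 κ.2)), Finset.univ_eq_attach,
    Finset.sum_attach (youngDiagramsOfCard N) fun κ' => stripSum W N (partsVec N κ.1) κ' • B κ']

theorem hallLittlewoodP_mem_span (κ : {κ // κ ∈ youngDiagramsOfCard N}) :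
    hallLittlewoodP (colVec N κ.1) ∈ Submodule.span ℤ[X] (Set.range
      fun κ : {κ // κ ∈ youngDiagramsOfCard N} =>
        ∏ i, elemSym (varX : Fin N → RatFunField N) (partsVec N κ.1 i)) :=
  mem_span_range_of_unitriangular (B := fun κ : {κ // κ ∈ youngDiagramsOfCard N} =>
    hallLittlewoodP (colVec N κ.1)) (fun κ => dominanceRank N κ.1)
    (stripSum_partsVec_diag fun _ _ _ => stripWeight_initial_rows X) stripSum_partsVec_triangular
    (prod_elemSym_eq_sum_subtype fun c hc => prod_elemSym_eq_sum_hallLittlewoodP c hc) κ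

theorem schurPoly_mem_span (κ : {κ // κ ∈ youngDiagramsOfCard N}) :
    schurPoly (colVec N κ.1) ∈ Submodule.span ℤ[X] (Set.range
      fun κ : {κ // κ ∈ youngDiagramsOfCard N} =>
        ∏ i, elemSym (varX : Fin N → RatFunField N) (partsVec N κ.1 i)) :=
  mem_span_range_of_unitriangular (B := fun κ : {κ // κ ∈ youngDiagramsOfCard N} =>
    schurPoly (colVec N κ.1)) (fun κ => dominanceRank N κ.1)
    (stripSum_partsVec_diag fun _ _ _ _ _ _ => rfl) stripSum_partsVec_triangular
    (prod_elemSym_eq_sum_subtype fun c hc => prod_elemSym_eq_sum_schurPoly c hc) κ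

theorem linearIndependent_hallLittlewoodP :
    LinearIndependent ℤ[X] fun κ : {κ // κ ∈ youngDiagramsOfCard N} =>
      hallLittlewoodP (colVec N κ.1) :=
  linearIndependent_of_mutual_span linearIndependent_prod_elemSym
    (prod_elemSym_eq_sum_subtype fun c hc => prod_elemSym_eq_sum_hallLittlewoodP c hc)
    hallLittlewoodP_mem_span

theorem sum_youngDiagrams_transpose {M : Type*} [AddCommMonoid M] (f : YoungDiagram → M) :
    ∑ η ∈ youngDiagramsOfCard N, f η.transpose = ∑ κ ∈ youngDiagramsOfCard N, f κ :=
  Finset.sum_nbij' YoungDiagram.transpose YoungDiagram.transpose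
    (fun η h => by simpa [card_transpose] using h) (fun η h => by simpa [card_transpose] using h)
    (fun η _ => YoungDiagram.transpose_transpose η) (fun η _ => YoungDiagram.transpose_transpose η)
    fun η _ => rfl

/-- A Schur polynomial lies in the span of the products of elementary symmetric polynomials, which
in turn lie in the span of the Hall–Littlewood polynomials. -/
theorem exists_isKostkaFoulkesRow (ξ : YoungDiagram) : ∃ K, IsKostkaFoulkesRow ξ K := by
  classical
  have hξ : ξ.transpose ∈ youngDiagramsOfCard ξ.card := by simp [card_transpose]
  have h1 := schurPoly_mem_span ⟨ξ.transpose, hξ⟩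
  have h2 : Submodule.span ℤ[X] (Set.range
      fun κ : {κ // κ ∈ youngDiagramsOfCard ξ.card} =>
        ∏ i, elemSym (varX : Fin ξ.card → RatFunField ξ.card) (partsVec ξ.card κ.1 i)) ≤
      Submodule.span ℤ[X] (Set.range fun κ : {κ // κ ∈ youngDiagramsOfCard ξ.card} =>
        hallLittlewoodP (colVec ξ.card κ.1)) := by
    rw [Submodule.span_le]
    rintro _ ⟨κ, rfl⟩
    simp only [SetLike.mem_coe]
    rw [prod_elemSym_eq_sum_subtype (fun c hc => prod_elemSym_eq_sum_hallLittlewoodP c hc) κ]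
    exact Submodule.sum_mem _ fun κ' _ => Submodule.smul_mem _ _ (Submodule.subset_span ⟨κ', rfl⟩)
  obtain ⟨c, hc⟩ := (Submodule.mem_span_range_iff_exists_fun _).1 (h2 h1)
  refine ⟨fun η => if h : η.transpose ∈ youngDiagramsOfCard ξ.card then c ⟨η.transpose, h⟩ else 0,
    fun η hη => dif_neg (by simpa [card_transpose] using hη), ?_⟩
  rw [partsVec_eq_colVec, ← hc]
  simp only [partsVec_eq_colVec, constQ_eq_algebraMap, ← Algebra.smul_def]
  rw [sum_youngDiagrams_transpose fun κ : YoungDiagram =>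
    (if h : κ ∈ youngDiagramsOfCard ξ.card then c ⟨κ, h⟩ else 0 : ℤ[X]) •
      (hallLittlewoodP (colVec ξ.card κ) : RatFunField ξ.card), Finset.univ_eq_attach]
  refine Eq.trans ?_ (Finset.sum_attach (youngDiagramsOfCard ξ.card) _)
  refine Finset.sum_congr rfl fun κ _ => ?_
  rw [dif_pos κ.2]

theorem isKostkaFoulkesRow_kostkaFoulkes (ξ : YoungDiagram) :
    IsKostkaFoulkesRow ξ (kostkaFoulkes ξ) := by
  have h := exists_isKostkaFoulkesRow ξ
  have : kostkaFoulkes ξ = h.choose := funext fun η => by rw [kostkaFoulkes, dif_pos h]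
  rw [this]
  exact h.choose_spec

end Bases

/-! ### The branching rule for Schur polynomials -/

section Branching

variable {R : Type*} [CommRing R]

theorem sum_Ico_pow_mul_pow (x y : R) {a b : ℕ} (h : b ≤ a) :
    (x - y) * ∑ k ∈ Finset.Ico b a, x ^ k * y ^ (a - 1 - k) = x ^ a - y ^ (a - b) * x ^ b := by
  obtain ⟨d, rfl⟩ := Nat.exists_eq_add_of_le h
  rw [Finset.sum_Ico_eq_sum_range, Nat.add_sub_cancel_left]
  have h1 := (Commute.all x y).mul_geom_sum₂ d
  have h2 : ∑ i ∈ Finset.range d, x ^ (b + i) * y ^ (b + d - 1 - (b + i)) =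
      x ^ b * ∑ i ∈ Finset.range d, x ^ i * y ^ (d - 1 - i) := by
    rw [Finset.mul_sum]
    refine Finset.sum_congr rfl fun i _ => ?_
    rw [pow_add, mul_assoc, show b + d - 1 - (b + i) = d - 1 - i by omega]
  rw [h2, pow_add]
  linear_combination x ^ b * h1

/-- Expansion of an alternant in `N + 1` variables into alternants in the first `N` of them. Column
operations make the row of the last variable trivial and leave in the other columns the quotients
`(x^a - y^{a-b} x^b) / (x - y) = ∑_{b ≤ k < a} x^k y^{a-1-k}`. -/
theorem alternantAt_succ {N : ℕ} (y : Fin (N + 1) → R) {α : Fin (N + 1) → ℕ} (hα : Antitone α) :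
    alternantAt y α = (∏ i : Fin N, (y i.castSucc - y (Fin.last N))) *
      ∑ β ∈ Fintype.piFinset fun j : Fin N => Finset.Ico (α j.succ) (α j.castSucc),
        alternantAt (fun i => y i.castSucc) β *
          ((∏ j : Fin N, y (Fin.last N) ^ (α j.castSucc - 1 - β j)) *
            y (Fin.last N) ^ α (Fin.last N)) := by
  set z := y (Fin.last N) with hz
  let A : Matrix (Fin (N + 1)) (Fin (N + 1)) R := Matrix.of fun i j => y i.rev ^ α j.rev
  let D : Matrix (Fin N) (Fin N) R := Matrix.of fun i j =>
    (y i.castSucc - z) *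
      ∑ k ∈ Finset.Ico (α j.succ) (α j.castSucc), y i.castSucc ^ k * z ^ (α j.castSucc - 1 - k)
  let c : Fin N → R := fun j => z ^ (α j.rev.castSucc - α j.rev.succ)
  let B : Matrix (Fin (N + 1)) (Fin (N + 1)) R := Matrix.of fun i j =>
    Fin.cases (motive := fun _ => R) (A i 0) (fun j => A i j.succ - c j * A i j.castSucc) j
  have hA : alternantAt y α = A.det :=
    (Matrix.det_submatrix_equiv_self Fin.revPerm (Matrix.of fun i j => y i ^ α j)).symm
  have hAB : A.det = B.det := by
    refine Matrix.det_eq_of_forall_col_eq_smul_add_pred c (fun i => rfl) fun i j => ?_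
    simp only [B, Matrix.of_apply, Fin.cases_succ, sub_add_cancel]
  have hle : ∀ j : Fin N, α j.succ ≤ α j.castSucc := fun j => hα (Fin.castSucc_lt_succ).le
  have hB0 : ∀ j : Fin N, B 0 j.succ = 0 := by
    intro j
    simp only [B, A, c, Matrix.of_apply, Fin.cases_succ, Fin.rev_zero, ← hz, Fin.rev_succ,
      Fin.rev_castSucc]
    rw [← pow_add, Nat.sub_add_cancel (hle _), sub_self]
  have hBD : B.submatrix Fin.succ Fin.succ = D.submatrix Fin.revPerm Fin.revPerm := by
    ext i j
    simp only [B, A, c, D, Matrix.submatrix_apply, Matrix.of_apply, Fin.cases_succ, Fin.rev_succ,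
      Fin.rev_castSucc, Fin.revPerm_apply]
    rw [sum_Ico_pow_mul_pow _ _ (hle _)]
  have hBdet : B.det = z ^ α (Fin.last N) * D.det := by
    rw [Matrix.det_succ_row_zero, Fin.sum_univ_succ, Finset.sum_eq_zero fun j _ => by
      rw [hB0, mul_zero, zero_mul], add_zero]
    simp only [Fin.coe_ofNat_eq_mod, Nat.zero_mod, pow_zero, one_mul]
    rw [show (B.submatrix Fin.succ (Fin.succAbove 0)) = B.submatrix Fin.succ Fin.succ from by
      ext i j; simp [Fin.succAbove_zero], hBD, Matrix.det_submatrix_equiv_self]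
    simp only [B, A, Matrix.of_apply, Fin.cases_zero, Fin.rev_zero, ← hz]
  have hD : D.det = (∏ i : Fin N, (y i.castSucc - z)) *
      (Matrix.of fun i j : Fin N => ∑ k ∈ Finset.Ico (α j.succ) (α j.castSucc),
        y i.castSucc ^ k * z ^ (α j.castSucc - 1 - k)).det :=
    Matrix.det_mul_column (fun i : Fin N => y i.castSucc - z)
      (Matrix.of fun i j : Fin N => ∑ k ∈ Finset.Ico (α j.succ) (α j.castSucc),
        y i.castSucc ^ k * z ^ (α j.castSucc - 1 - k))
  have hmulti : (Matrix.of fun i j : Fin N => ∑ k ∈ Finset.Ico (α j.succ) (α j.castSucc),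
        y i.castSucc ^ k * z ^ (α j.castSucc - 1 - k)).det =
      ∑ β ∈ Fintype.piFinset fun j : Fin N => Finset.Ico (α j.succ) (α j.castSucc),
        alternantAt (fun i => y i.castSucc) β * ∏ j : Fin N, z ^ (α j.castSucc - 1 - β j) := by
    simp only [Matrix.det_apply', Matrix.of_apply, alternantAt, Finset.sum_mul]
    rw [Finset.sum_comm]
    refine Finset.sum_congr rfl fun w _ => ?_
    rw [Finset.prod_univ_sum, Finset.mul_sum]
    refine Finset.sum_congr rfl fun β _ => ?_
    rw [Finset.prod_mul_distrib, mul_assoc]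
  rw [hA, hAB, hBdet, hD, hmulti, mul_left_comm, Finset.mul_sum]
  congr 1
  refine Finset.sum_congr rfl fun β _ => ?_
  ring

theorem finite_allStrips (κ : YoungDiagram) :
    {ν : YoungDiagram | IsHorizontalStrip ν κ (κ.card - ν.card)}.Finite :=
  (finite_youngDiagrams_le κ).subset fun _ h => h.1

/-- The diagrams obtained from `κ` by removing a horizontal strip of any length. -/
def allStrips (κ : YoungDiagram) : Finset YoungDiagram :=
  (finite_allStrips κ).toFinset

theorem mem_allStrips {κ ν : YoungDiagram} :
    ν ∈ allStrips κ ↔ IsHorizontalStrip ν κ (κ.card - ν.card) := by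
  simp [allStrips]

theorem mem_allStrips_iff {κ ν : YoungDiagram} :
    ν ∈ allStrips κ ↔ ν ≤ κ ∧ ∀ k, κ.rowLen (k + 1) ≤ ν.rowLen k := by
  rw [mem_allStrips, isHorizontalStrip_iff]
  refine and_congr_right fun h => and_iff_right ?_
  have : ν.card ≤ κ.card := Finset.card_le_card (YoungDiagram.cells_subset_iff.2 h)
  omega

theorem partsVec_injOn {N : ℕ} {ν κ : YoungDiagram} (hν : ν.colLen 0 ≤ N) (hκ : κ.colLen 0 ≤ N)
    (h : partsVec N ν = partsVec N κ) : ν = κ := by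
  refine ext_rowLen fun k => ?_
  rcases Nat.lt_or_ge k N with hk | hk
  · exact congrFun h ⟨k, hk⟩
  · rw [rowLen_eq_zero (hν.trans hk), rowLen_eq_zero (hκ.trans hk)]

theorem exists_rowLen_eq {N : ℕ} {f : Fin N → ℕ} (hf : Antitone f) :
    ∃ κ : YoungDiagram, κ.colLen 0 ≤ N ∧ ∀ i : Fin N, κ.rowLen i = f i := by
  obtain ⟨ρ, h1, h2⟩ := exists_colLen_eq hf
  exact ⟨ρ.transpose, by rwa [YoungDiagram.colLen_transpose],
    fun i => by rw [YoungDiagram.rowLen_transpose, h2]⟩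

/-- The branching rule in terms of alternants. -/
theorem alternantAt_partsVec_succ {N : ℕ} (y : Fin (N + 1) → R) {ξ : YoungDiagram}
    (hξ : ξ.colLen 0 ≤ N + 1) :
    alternantAt y (partsVec (N + 1) ξ + staircase (N + 1)) =
      (∏ i : Fin N, (y i.castSucc - y (Fin.last N))) *
        ∑ η ∈ (allStrips ξ).filter fun η => η.colLen 0 ≤ N,
          alternantAt (fun i => y i.castSucc) (partsVec N η + staircase N) *
            y (Fin.last N) ^ (ξ.card - η.card) := by
  have hanti : Antitone (partsVec (N + 1) ξ + staircase (N + 1)) := by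
    intro i j hij
    have h1 := ξ.rowLen_anti i j hij
    rw [Fin.le_def] at hij
    simp only [Pi.add_apply, partsVec, staircase]
    omega
  rw [alternantAt_succ y hanti]
  congr 1
  symm
  refine Finset.sum_bij (fun η _ => partsVec N η + staircase N) ?_ ?_ ?_ ?_
  · intro η hη
    obtain ⟨h1, h2⟩ := Finset.mem_filter.1 hη
    obtain ⟨h3, h4⟩ := mem_allStrips_iff.1 h1
    rw [Fintype.mem_piFinset]
    intro j
    have h5 := le_iff_rowLen_le.1 h3 j
    have h6 := h4 j
    have hj := j.isLt
    simp only [Finset.mem_Ico, Pi.add_apply, partsVec, staircase, Fin.val_succ, Fin.val_castSucc]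
    omega
  · intro η hη η' hη' heq
    exact partsVec_injOn (Finset.mem_filter.1 hη).2 (Finset.mem_filter.1 hη').2
      (add_right_cancel heq)
  · intro β hβ
    rw [Fintype.mem_piFinset] at hβ
    simp only [Finset.mem_Ico, Pi.add_apply, partsVec, staircase, Fin.val_succ,
      Fin.val_castSucc] at hβ
    have hstep : ∀ i j : Fin N, i ≤ j → β j + (j - i : ℕ) ≤ β i := by
      intro i j hij
      rcases hij.lt_or_eq with h | rfl
      · have h1 := (hβ i).1
        have h2 := (hβ j).2
        have h3 := ξ.rowLen_anti (i + 1) j h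
        rw [Fin.lt_def] at h
        have := j.isLt
        omega
      · simp
    obtain ⟨η, h1, h2⟩ := exists_rowLen_eq (f := fun j : Fin N => β j - (N - 1 - j)) (by
      intro i j hij
      have h3 := hstep i j hij
      have h4 := (hβ j).1
      rw [Fin.le_def] at hij
      have := j.isLt
      simp only
      omega)
    refine ⟨η, Finset.mem_filter.2 ⟨mem_allStrips_iff.2 ⟨le_iff_rowLen_le.2 fun k => ?_,
      fun k => ?_⟩, h1⟩, ?_⟩
    · rcases Nat.lt_or_ge k N with hk | hk
      · have h3 := h2 ⟨k, hk⟩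
        have h4 := hβ ⟨k, hk⟩
        simp only at h3 h4
        omega
      · rw [rowLen_eq_zero (h1.trans hk)]; exact Nat.zero_le _
    · rcases Nat.lt_or_ge k N with hk | hk
      · have h3 := h2 ⟨k, hk⟩
        have h4 := hβ ⟨k, hk⟩
        simp only at h3 h4
        omega
      · rw [rowLen_eq_zero (ν := ξ) (by omega)]; exact Nat.zero_le _
    · funext j
      have h3 := h2 j
      have h4 := (hβ j).1
      have := j.isLt
      simp only [Pi.add_apply, partsVec, staircase]
      omega
  · intro η hη
    obtain ⟨h1, h2⟩ := Finset.mem_filter.1 hη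
    obtain ⟨h3, h4⟩ := mem_allStrips_iff.1 h1
    congr 1
    rw [Finset.prod_pow_eq_pow_sum, ← pow_add]
    congr 1
    have e1 : ∀ j : Fin N, (partsVec (N + 1) ξ + staircase (N + 1)) j.castSucc - 1 -
        (partsVec N η + staircase N) j = ξ.rowLen j - η.rowLen j := by
      intro j
      have h5 := le_iff_rowLen_le.1 h3 j
      have hj := j.isLt
      simp only [Pi.add_apply, partsVec, staircase, Fin.val_castSucc]
      omega
    have e2 : (partsVec (N + 1) ξ + staircase (N + 1)) (Fin.last N) = ξ.rowLen N := by
      simp [partsVec, staircase]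
    simp only [e1, e2]
    rw [card_eq_sum_rowLen ξ hξ, card_eq_sum_rowLen η h2, Finset.sum_range_succ,
      Fin.sum_univ_eq_sum_range (fun j => ξ.rowLen j - η.rowLen j) N,
      Finset.sum_tsub_distrib _ fun j _ => le_iff_rowLen_le.1 h3 j]
    have := Finset.sum_le_sum fun j (_ : j ∈ Finset.range N) => le_iff_rowLen_le.1 h3 j
    omega

theorem alternantAt_staircase_succ {N : ℕ} (y : Fin (N + 1) → R) :
    alternantAt y (staircase (N + 1)) = (∏ i : Fin N, (y i.castSucc - y (Fin.last N))) *
      alternantAt (fun i => y i.castSucc) (staircase N) := by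
  have h := alternantAt_partsVec_succ y (ξ := ⊥) (by rw [colLen_bot]; exact Nat.zero_le _)
  have hp : ∀ n, partsVec n ⊥ = 0 := fun n => funext fun i => rowLen_bot i
  have hs : ((allStrips ⊥).filter fun η => η.colLen 0 ≤ N) = {⊥} := by
    ext η
    simp only [Finset.mem_filter, mem_allStrips_iff, Finset.mem_singleton, le_bot_iff]
    constructor
    · exact fun h => h.1.1
    · rintro rfl
      simp [rowLen_bot, colLen_bot]
  rw [hs, Finset.sum_singleton, hp, hp, zero_add, zero_add, card_bot] at h
  simpa using h

/-- The Schur polynomial is the generating function of chains of horizontal strips. The bound `b`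
on the strip lengths only makes the sum finite. -/
theorem alternantAt_partsVec (b : ℕ) : ∀ (N : ℕ) (y : Fin N → R) (ξ : YoungDiagram),
    ξ.colLen 0 ≤ N → ξ.card ≤ b →
      alternantAt y (partsVec N ξ + staircase N) = alternantAt y (staircase N) *
        ∑ c : Fin N → Fin (b + 1),
          stripSum (fun _ _ => (1 : R)) N (fun i => c i) ξ * ∏ i, y i ^ (c i : ℕ) := by
  intro N
  induction N with
  | zero =>
    intro y ξ h _
    have h1 : ξ = ⊥ := by
      rw [← card_eq_zero_iff, card_eq_sum_rowLen ξ h]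
      simp
    simp [alternantAt, stripSum, h1]
  | succ N ih =>
    intro y ξ h hb
    rw [alternantAt_partsVec_succ y h, alternantAt_staircase_succ, mul_assoc]
    congr 1
    have e1 : ∀ η ∈ (allStrips ξ).filter (fun η => η.colLen 0 ≤ N),
        alternantAt (fun i => y i.castSucc) (partsVec N η + staircase N) *
          y (Fin.last N) ^ (ξ.card - η.card) =
        alternantAt (fun i => y i.castSucc) (staircase N) *
          ((∑ c : Fin N → Fin (b + 1), stripSum (fun _ _ => (1 : R)) N (fun i => c i) η *
            ∏ i, y i.castSucc ^ (c i : ℕ)) * y (Fin.last N) ^ (ξ.card - η.card)) := by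
      intro η hη
      obtain ⟨h1, h2⟩ := Finset.mem_filter.1 hη
      rw [ih _ η h2 ((Finset.card_le_card (YoungDiagram.cells_subset_iff.2
        (mem_allStrips_iff.1 h1).1)).trans hb), mul_assoc]
    rw [Finset.sum_congr rfl e1, ← Finset.mul_sum]
    congr 1
    rw [Finset.sum_filter_of_ne]
    · rw [← Equiv.sum_comp (Fin.snocEquiv fun _ : Fin (N + 1) => Fin (b + 1)),
        Fintype.sum_prod_type]
      have e2 : ∀ m : Fin (b + 1), ∑ c : Fin N → Fin (b + 1),
          stripSum (fun _ _ => (1 : R)) (N + 1)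
            (fun i => ((Fin.snocEquiv fun _ : Fin (N + 1) => Fin (b + 1)) (m, c) i : ℕ)) ξ *
          ∏ i, y i ^ ((Fin.snocEquiv fun _ : Fin (N + 1) => Fin (b + 1)) (m, c) i : ℕ) =
          ∑ η ∈ stripsBelow ξ m, (∑ c : Fin N → Fin (b + 1),
            stripSum (fun _ _ => (1 : R)) N (fun i => c i) η *
              ∏ i, y i.castSucc ^ (c i : ℕ)) * y (Fin.last N) ^ (ξ.card - η.card) := by
        intro m
        simp only [Finset.sum_mul]
        rw [Finset.sum_comm]
        refine Finset.sum_congr rfl fun c _ => ?_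
        rw [stripSum_succ, Fin.prod_univ_castSucc]
        simp only [Fin.snocEquiv_apply, Fin.snoc_castSucc, Fin.snoc_last, mul_one]
        rw [Finset.sum_mul]
        refine Finset.sum_congr rfl fun η hη => ?_
        have : ξ.card - η.card = m := by
          have := (isHorizontalStrip_iff.1 (mem_stripsBelow.1 hη)).2.1
          omega
        rw [this, mul_assoc]
      rw [Finset.sum_congr rfl fun m _ => e2 m, Fin.sum_univ_eq_sum_range (fun m =>
        ∑ η ∈ stripsBelow ξ m, (∑ c : Fin N → Fin (b + 1),
            stripSum (fun _ _ => (1 : R)) N (fun i => c i) η *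
              ∏ i, y i.castSucc ^ (c i : ℕ)) * y (Fin.last N) ^ (ξ.card - η.card)) (b + 1),
        ← Finset.sum_fiberwise_of_maps_to (s := allStrips ξ) (t := Finset.range (b + 1))
          (g := fun η => ξ.card - η.card) (fun η _ => by
            rw [Finset.mem_range]; omega)]
      refine Finset.sum_congr rfl fun m _ => Finset.sum_congr ?_ fun _ _ => rfl
      ext η
      simp only [Finset.mem_filter, mem_allStrips, mem_stripsBelow]
      constructor
      · rintro ⟨h1, rfl⟩
        exact h1
      · intro h1
        have h2 := (isHorizontalStrip_iff.1 h1).2.1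
        have h3 : ξ.card - η.card = m := by omega
        exact ⟨h3 ▸ h1, h3⟩
    · intro η _ hne
      obtain ⟨c, -, hc⟩ := Finset.exists_ne_zero_of_sum_ne_zero (left_ne_zero_of_mul hne)
      exact (stripSum_triangular N _ _ (left_ne_zero_of_mul hc)).1

end Branching

/-! ### Specialization at `q = 1` -/

section Specialization

variable {N : ℕ}

theorem blockNorm_one_eq_card (l : Fin N → ℕ) :
    blockNorm (1 : ℤ) l =
      ((Finset.univ.filter fun w : Equiv.Perm (Fin N) => l ∘ w = l).card : ℤ) := by
  have h := DomMulAct.stabilizer_card' l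
  rw [← Fintype.card_subtype, h, blockNorm]
  push_cast
  exact Finset.prod_congr rfl fun k _ => by rw [gaussFact_one, Fintype.card_subtype]

theorem map_blockNorm {A B : Type*} [CommRing A] [CommRing B] (f : A →+* B) (q : A)
    (l : Fin N → ℕ) : f (blockNorm q l) = blockNorm (f q) l := by
  simp [blockNorm, map_gaussFact]

theorem blockNorm_one_ne_zero (l : Fin N → ℕ) : blockNorm (1 : ℤ) l ≠ 0 := by
  refine Finset.prod_ne_zero_iff.2 fun k _ => ?_
  rw [gaussFact_one]
  exact_mod_cast Nat.factorial_ne_zero _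

/-- Weakly decreasing vectors that are rearrangements of each other are equal. -/
theorem eq_of_comp_perm_eq {l l' : Fin N → ℕ} (hl : Antitone l) (hl' : Antitone l')
    (w : Equiv.Perm (Fin N)) (h : ∀ i, l' (w i) = l i) : l = l' := by
  have hlow : ∀ {f : Fin N → ℕ}, Antitone f → ∀ k i,
      k < f i ↔ (i : ℕ) < (Finset.univ.filter fun i => k < f i).card := by
    intro f hf k i
    rw [← mem_iff_lt_card_of_lower]
    · simp
    · intro i hi j hj
      simp only [Finset.mem_filter, Finset.mem_univ, true_and] at hi ⊢
      exact hi.trans_le (hf hj)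
  have hcard : ∀ k, (Finset.univ.filter fun i => k < l i).card =
      (Finset.univ.filter fun i => k < l' i).card := by
    intro k
    refine Finset.card_bij' (fun i _ => w i) (fun i _ => w.symm i) ?_ ?_ ?_ ?_
    · intro i hi
      simpa [h] using hi
    · intro i hi
      simpa [← h] using hi
    · simp
    · simp
  funext i
  have key : ∀ k, k < l i ↔ k < l' i := fun k => by rw [hlow hl, hlow hl', hcard]
  have h1 := key (l i)
  have h2 := key (l' i)
  omega

/-- The product `∏_{i<j} (z_i - q z_j)`. -/
def shiftedDiffProd {R : Type*} [CommRing R] (q : R) (z : Fin N → R) : R :=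
  ∏ i, ∏ j ∈ Finset.Ioi i, (z i - q * z j)

theorem map_shiftedDiffProd {R S : Type*} [CommRing R] [CommRing S] (f : R →+* S) (q : R)
    (z : Fin N → R) : f (shiftedDiffProd q z) = shiftedDiffProd (f q) fun i => f (z i) := by
  simp [shiftedDiffProd]

theorem shiftedDiffProd_one_eq_det {R : Type*} [CommRing R] (z : Fin N → R) :
    shiftedDiffProd 1 z = (Matrix.vandermonde fun i => -z i).det := by
  rw [Matrix.det_vandermonde, shiftedDiffProd]
  refine Finset.prod_congr rfl fun i _ => Finset.prod_congr rfl fun j _ => ?_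
  ring

theorem shiftedDiffProd_one_sq_perm {R : Type*} [CommRing R] (z : Fin N → R)
    (w : Equiv.Perm (Fin N)) :
    shiftedDiffProd 1 (fun i => z (w i)) ^ 2 = shiftedDiffProd 1 z ^ 2 := by
  rw [shiftedDiffProd_one_eq_det, shiftedDiffProd_one_eq_det,
    show (Matrix.vandermonde fun i => -z (w i)) =
      (Matrix.vandermonde fun i => -z i).submatrix w id from rfl, Matrix.det_permute, mul_pow]
  rcases Int.units_eq_one_or (Equiv.Perm.sign w) with h | h <;> simp [h]

theorem shiftedDiffProd_one_ne_zero {R : Type*} [CommRing R] [IsDomain R] {z : Fin N → R}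
    (hz : Function.Injective z) : shiftedDiffProd 1 z ≠ 0 := by
  rw [shiftedDiffProd_one_eq_det]
  exact Matrix.det_vandermonde_ne_zero_iff.2 fun a b h => hz (neg_injective h)

theorem hlKernel_mul_shiftedDiffProd {A : Type*} [Field A] (q : A) {z : Fin N → A}
    (hz : Function.Injective z) : hlKernel q z * shiftedDiffProd 1 z = shiftedDiffProd q z := by
  unfold hlKernel shiftedDiffProd
  rw [← Finset.prod_mul_distrib]
  refine Finset.prod_congr rfl fun i _ => ?_
  rw [← Finset.prod_mul_distrib]
  refine Finset.prod_congr rfl fun j hj => ?_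
  have hne : z i - z j ≠ 0 := sub_ne_zero.2 fun h => (Finset.mem_Ioi.1 hj).ne (hz h)
  rw [one_mul, div_mul_cancel₀ _ hne]

/-- The specialization at `q = 1` of polynomials with coefficients in `ℤ[q]`. -/
def specializeOne (N : ℕ) : MvPolynomial (Fin N) ℤ[X] →+* MvPolynomial (Fin N) ℤ :=
  MvPolynomial.map (evalRingHom (1 : ℤ))

/-- At `q = 1` a Hall–Littlewood polynomial is, up to the order of the stabilizer of its exponent
vector, the sum of all rearrangements of the monomial of that vector. -/
theorem specializeOne_hallLittlewoodP {l : Fin N → ℕ} {p : MvPolynomial (Fin N) ℤ[X]}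
    (hp : algebraMap (MvPolynomial (Fin N) ℤ[X]) (RatFunField N) p = hallLittlewoodP l) :
    MvPolynomial.C (blockNorm (1 : ℤ) l) * specializeOne N p =
      ∑ w : Equiv.Perm (Fin N), ∏ i, MvPolynomial.X (w i) ^ l i := by
  set φ := algebraMap (MvPolynomial (Fin N) ℤ[X]) (RatFunField N) with hφ
  have hinj : Function.Injective φ := IsFractionRing.injective _ _
  have hX : ∀ i : Fin N, φ (MvPolynomial.X i) = varX i := fun _ => rfl
  have hC : ∀ c : ℤ[X], φ (MvPolynomial.C c) = constQ N c := fun _ => rfl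
  -- clear denominators with the square of the Vandermonde product, which is symmetric
  have main : MvPolynomial.C (blockNorm X l) * p * shiftedDiffProd 1 MvPolynomial.X ^ 2 =
      ∑ w : Equiv.Perm (Fin N), (∏ i, MvPolynomial.X (w i) ^ l i) *
        (shiftedDiffProd (MvPolynomial.C X) (fun i => MvPolynomial.X (w i)) *
          shiftedDiffProd 1 fun i => MvPolynomial.X (w i)) := by
    apply hinj
    have hb : constQ N (blockNorm X l) = blockNorm (constQ N X) l := by
      rw [constQ_eq_algebraMap, constQ_eq_algebraMap, map_blockNorm]
    have hb0 : blockNorm (constQ N X) l ≠ 0 := blockNorm_ne_zero gaussFact_constQ_ne_zero l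
    rw [map_mul, map_mul, hC, hb, hp, hallLittlewoodP_eq, mul_div_cancel₀ _ hb0, permSum,
      Finset.sum_mul, map_sum]
    refine Finset.sum_congr rfl fun w _ => ?_
    simp only [map_mul, map_pow, map_prod, map_shiftedDiffProd, hX, hC, map_one]
    have hk := hlKernel_mul_shiftedDiffProd (constQ N X) (varX_injective.comp w.injective)
    simp only [Function.comp_def] at hk
    rw [← shiftedDiffProd_one_sq_perm _ w, ← hk]
    ring
  have hs := congrArg (specializeOne N) main
  have sX : ∀ i : Fin N, specializeOne N (MvPolynomial.X i) = MvPolynomial.X i := fun i => by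
    simp [specializeOne]
  have sC : ∀ c : ℤ[X], specializeOne N (MvPolynomial.C c) = MvPolynomial.C (c.eval 1) :=
    fun c => by simp [specializeOne]
  have hbl : (blockNorm X l : ℤ[X]).eval 1 = blockNorm 1 l := by
    rw [← coe_evalRingHom, map_blockNorm]; simp
  simp only [map_mul, map_pow, map_sum, map_prod, map_shiftedDiffProd, sX, sC, map_one, hbl,
    eval_X, ← sq, shiftedDiffProd_one_sq_perm] at hs
  rw [← Finset.sum_mul] at hs
  exact mul_right_cancel₀ (pow_ne_zero 2 (shiftedDiffProd_one_ne_zero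
    (MvPolynomial.X_injective))) hs

theorem prod_X_pow_perm (l : Fin N → ℕ) (w : Equiv.Perm (Fin N)) :
    ∏ i, (MvPolynomial.X (w i) : MvPolynomial (Fin N) ℤ) ^ l i =
      MvPolynomial.monomial (Finsupp.equivFunOnFinite.symm fun i => l (w.symm i)) 1 := by
  rw [MvPolynomial.monomial_eq, Finsupp.prod_fintype _ _ fun _ => pow_zero _, map_one, one_mul,
    ← Equiv.prod_comp w fun j => (MvPolynomial.X j : MvPolynomial (Fin N) ℤ) ^
      (Finsupp.equivFunOnFinite.symm fun i => l (w.symm i)) j]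
  simp

theorem coeff_specializeOne_hallLittlewoodP {l l' : Fin N → ℕ} (hl : Antitone l)
    (hl' : Antitone l') {p : MvPolynomial (Fin N) ℤ[X]}
    (hp : algebraMap (MvPolynomial (Fin N) ℤ[X]) (RatFunField N) p = hallLittlewoodP l) :
    (specializeOne N p).coeff (Finsupp.equivFunOnFinite.symm l') = if l = l' then 1 else 0 := by
  have h := congrArg (MvPolynomial.coeff (Finsupp.equivFunOnFinite.symm l'))
    (specializeOne_hallLittlewoodP hp)
  simp only [prod_X_pow_perm, MvPolynomial.coeff_C_mul, MvPolynomial.coeff_sum,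
    MvPolynomial.coeff_monomial, EmbeddingLike.apply_eq_iff_eq] at h
  split_ifs with heq
  · subst heq
    rw [Finset.sum_boole, blockNorm_one_eq_card] at h
    have hcard : (Finset.univ.filter fun w : Equiv.Perm (Fin N) =>
        (fun i => l (w.symm i)) = l).card =
        (Finset.univ.filter fun w : Equiv.Perm (Fin N) => l ∘ w = l).card :=
      Finset.card_bij' (fun w _ => w.symm) (fun w _ => w.symm)
        (fun w hw => by simpa [Function.comp_def] using hw)
        (fun w hw => by simpa [Function.comp_def] using hw) (by simp) (by simp)
    rw [hcard, ← blockNorm_one_eq_card] at h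
    exact mul_left_cancel₀ (blockNorm_one_ne_zero l) (h.trans (mul_one _).symm)
  · rw [Finset.sum_eq_zero] at h
    · exact (mul_eq_zero.1 h).resolve_left (blockNorm_one_ne_zero l)
    · intro w _
      refine if_neg fun hw => heq ?_
      exact (eq_of_comp_perm_eq hl' hl w.symm fun i => congrFun hw i).symm

theorem exists_polynomial_hallLittlewoodP {η : YoungDiagram} (h : η.card = N) :
    ∃ p : MvPolynomial (Fin N) ℤ[X],
      algebraMap (MvPolynomial (Fin N) ℤ[X]) (RatFunField N) p =
        hallLittlewoodP (partsVec N η) := by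
  have h1 := hallLittlewoodP_mem_span (N := N)
    ⟨η.transpose, by rw [mem_youngDiagramsOfCard, card_transpose, h]⟩
  have h2 : Submodule.span ℤ[X] (Set.range fun κ : {κ // κ ∈ youngDiagramsOfCard N} =>
        ∏ i, elemSym (varX : Fin N → RatFunField N) (partsVec N κ.1 i)) ≤
      LinearMap.range (IsScalarTower.toAlgHom ℤ[X] (MvPolynomial (Fin N) ℤ[X])
        (RatFunField N)).toLinearMap := by
    rw [Submodule.span_le]
    rintro _ ⟨κ, rfl⟩
    refine ⟨∏ i, elemSym MvPolynomial.X (partsVec N κ.1 i), ?_⟩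
    simp [elemSym, varX]
  obtain ⟨p, hp⟩ := h2 h1
  exact ⟨p, by rw [partsVec_eq_colVec]; exact hp⟩

/-- At `q = 1` the Kostka–Foulkes polynomial counts chains of horizontal strips, that is,
semistandard tableaux. -/
theorem eval_one_kostkaFoulkes {ξ η : YoungDiagram} (h : η.card = ξ.card) :
    (kostkaFoulkes ξ η).eval 1 =
      stripSum (fun _ _ => (1 : ℤ)) ξ.card (partsVec ξ.card η) ξ := by
  classical
  set N := ξ.card with hN
  choose p hp using fun τ : {τ // τ ∈ youngDiagramsOfCard N} =>
    exists_polynomial_hallLittlewoodP (mem_youngDiagramsOfCard.1 τ.2)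
  have hrow := (isKostkaFoulkesRow_kostkaFoulkes ξ).2
  have hs := alternantAt_partsVec N N (MvPolynomial.X : Fin N → MvPolynomial (Fin N) ℤ[X]) ξ
    (colLen_zero_le_card ξ) le_rfl
  set s := ∑ c : Fin N → Fin (N + 1),
    stripSum (fun _ _ => (1 : MvPolynomial (Fin N) ℤ[X])) N (fun i => c i) ξ *
      ∏ i, MvPolynomial.X i ^ (c i : ℕ) with hs_def
  have hschur : algebraMap (MvPolynomial (Fin N) ℤ[X]) (RatFunField N) s =
      schurPoly (partsVec N ξ) := by
    have := congrArg (algebraMap (MvPolynomial (Fin N) ℤ[X]) (RatFunField N)) hs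
    rw [map_mul, map_alternantAt, map_alternantAt] at this
    rw [schurPoly_eq, eq_div_iff alternantAt_varX_staircase_ne_zero, mul_comm]
    exact this.symm
  have hpoly : s = ∑ τ : {τ // τ ∈ youngDiagramsOfCard N},
      MvPolynomial.C (kostkaFoulkes ξ τ.1) * p τ := by
    apply IsFractionRing.injective (MvPolynomial (Fin N) ℤ[X]) (RatFunField N)
    rw [hschur, hrow, map_sum, Finset.univ_eq_attach, ← Finset.sum_attach]
    refine Finset.sum_congr rfl fun τ _ => ?_
    rw [map_mul, hp]
    rfl
  have hs1 := congrArg (fun f => (specializeOne N f).coeff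
    (Finsupp.equivFunOnFinite.symm (partsVec N η))) hpoly
  have hanti : ∀ τ : YoungDiagram, Antitone (partsVec N τ) := fun τ i j hij =>
    τ.rowLen_anti i j hij
  have hR : (specializeOne N (∑ τ : {τ // τ ∈ youngDiagramsOfCard N},
      MvPolynomial.C (kostkaFoulkes ξ τ.1) * p τ)).coeff
        (Finsupp.equivFunOnFinite.symm (partsVec N η)) = (kostkaFoulkes ξ η).eval 1 := by
    have sC : ∀ c : ℤ[X], specializeOne N (MvPolynomial.C c) = MvPolynomial.C (c.eval 1) :=
      fun c => by simp [specializeOne]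
    simp only [map_sum, map_mul, sC, MvPolynomial.coeff_sum, MvPolynomial.coeff_C_mul,
      coeff_specializeOne_hallLittlewoodP (hanti _) (hanti η) (hp _)]
    rw [Finset.sum_eq_single ⟨η, mem_youngDiagramsOfCard.2 h⟩]
    · simp
    · intro τ _ hne
      rw [if_neg, mul_zero]
      intro heq
      refine hne (Subtype.ext (partsVec_injOn ?_ ?_ heq))
      · exact (colLen_zero_le_card _).trans (mem_youngDiagramsOfCard.1 τ.2).le
      · exact (colLen_zero_le_card _).trans h.le
    · simp
  have hL : (specializeOne N s).coeff (Finsupp.equivFunOnFinite.symm (partsVec N η)) =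
      stripSum (fun _ _ => (1 : ℤ)) N (partsVec N η) ξ := by
    have hterm : ∀ c : Fin N → Fin (N + 1), specializeOne N
        (stripSum (fun _ _ => (1 : MvPolynomial (Fin N) ℤ[X])) N (fun i => c i) ξ *
          ∏ i, MvPolynomial.X i ^ (c i : ℕ)) =
        MvPolynomial.C (stripSum (fun _ _ => (1 : ℤ)) N (fun i => c i) ξ) *
          MvPolynomial.monomial (Finsupp.equivFunOnFinite.symm fun i => (c i : ℕ)) 1 := by
      intro c
      have h1 : ∏ i, (MvPolynomial.X i : MvPolynomial (Fin N) ℤ) ^ (c i : ℕ) =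
          MvPolynomial.monomial (Finsupp.equivFunOnFinite.symm fun i => (c i : ℕ)) 1 :=
        prod_X_pow_perm (fun i => (c i : ℕ)) 1
      rw [map_mul, map_stripSum, map_stripSum, map_one, map_one, ← h1]
      simp [specializeOne]
    simp only [s, map_sum, hterm, MvPolynomial.coeff_sum, MvPolynomial.coeff_C_mul,
      MvPolynomial.coeff_monomial, EmbeddingLike.apply_eq_iff_eq]
    have hle : ∀ i, partsVec N η i < N + 1 := fun i => by
      have h1 := η.rowLen_anti 0 i (Nat.zero_le _)
      have h2 := rowLen_zero_le_card η
      simp only [partsVec]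
      omega
    rw [Finset.sum_eq_single fun i => ⟨partsVec N η i, hle i⟩]
    · simp
    · intro c _ hne
      rw [if_neg, mul_zero]
      intro heq
      exact hne (funext fun i => Fin.ext (congrFun heq i))
    · simp
  rw [← hR, ← hL]
  exact hs1.symm

end Specialization

/-! ### Comparison of the two expansions -/

section Comparison

theorem rowLen_sortedDiagram {n : ℕ} (c : Fin n → ℕ) (i : ℕ) :
    (sortedDiagram c).rowLen i =
      ((Multiset.map c Finset.univ.val).sort (· ≥ ·)).getD i 0 := by
  unfold sortedDiagram
  set w := (Multiset.map c Finset.univ.val).sort (· ≥ ·) with hw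
  rcases Nat.lt_or_ge i w.length with h | h
  · have := YoungDiagram.rowLen_ofRowLens
      (hw := List.Pairwise.sortedGE (Multiset.pairwise_sort _ _)) (w := w) ⟨i, h⟩
    rw [List.getD_eq_getElem _ _ h]
    exact this
  · rw [List.getD_eq_default _ _ h]
    by_contra hc
    have := YoungDiagram.mem_iff_lt_rowLen.2 (Nat.pos_of_ne_zero hc)
    rw [YoungDiagram.mem_ofRowLens] at this
    obtain ⟨h1, -⟩ := this
    exact absurd h1 (not_lt.2 h)

theorem length_sort_map_univ {n : ℕ} (c : Fin n → ℕ) :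
    ((Multiset.map c Finset.univ.val).sort (· ≥ ·)).length = n := by
  rw [Multiset.length_sort, Multiset.card_map]
  simp

theorem colLen_sortedDiagram_le {n : ℕ} (c : Fin n → ℕ) : (sortedDiagram c).colLen 0 ≤ n := by
  by_contra hc
  have h := (lt_colLen_iff (sortedDiagram c)).1 (not_le.1 hc)
  rw [rowLen_sortedDiagram, List.getD_eq_default _ _ (length_sort_map_univ c).le] at h
  exact lt_irrefl _ h

/-- Symmetric products over a composition can be computed from its sorted diagram. -/
@[to_additive]
theorem prod_range_sortedDiagram {M : Type*} [CommMonoid M] {n : ℕ} (c : Fin n → ℕ) (f : ℕ → M)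
    (hf : f 0 = 1) {K : ℕ} (hK : (sortedDiagram c).colLen 0 ≤ K) :
    ∏ i ∈ Finset.range K, f ((sortedDiagram c).rowLen i) = ∏ a, f (c a) := by
  have hred : ∀ L, (sortedDiagram c).colLen 0 ≤ L →
      ∏ i ∈ Finset.range ((sortedDiagram c).colLen 0), f ((sortedDiagram c).rowLen i) =
        ∏ i ∈ Finset.range L, f ((sortedDiagram c).rowLen i) := fun L hL =>
    Finset.prod_subset (Finset.range_mono hL) fun i _ hi => by
      rw [rowLen_eq_zero (by simpa using hi), hf]
  set w := (Multiset.map c Finset.univ.val).sort (· ≥ ·) with hw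
  have hlen : w.length = n := length_sort_map_univ c
  have h1 : (w.map f).prod = ∏ a, f (c a) := by
    rw [← Multiset.prod_coe, ← Multiset.map_coe, hw, Multiset.sort_eq, Multiset.map_map]
    rfl
  rw [← hred K hK, hred w.length (by rw [hlen]; exact colLen_sortedDiagram_le c), ← h1,
    ← Fin.prod_univ_eq_prod_range, ← Fin.prod_univ_fun_getElem]
  refine Finset.prod_congr rfl fun i _ => ?_
  rw [rowLen_sortedDiagram, ← hw, List.getD_eq_getElem _ _ i.isLt]

theorem card_sortedDiagram {n : ℕ} (c : Fin n → ℕ) : (sortedDiagram c).card = ∑ a, c a := by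
  rw [card_eq_sum_rowLen _ le_rfl]
  exact sum_range_sortedDiagram c id rfl le_rfl

variable {N : ℕ}

theorem prod_elemSym_sortedDiagram {n : ℕ} {A : Type*} [CommRing A] (y : Fin N → A)
    (c : Fin n → ℕ) (hc : ∑ a, c a = N) :
    ∏ i, elemSym y (partsVec N (sortedDiagram c) i) = ∏ a, elemSym y (c a) := by
  rw [← prod_range_sortedDiagram c (elemSym y) (elemSym_zero y) (K := N)
    ((colLen_zero_le_card _).trans (by rw [card_sortedDiagram, hc])),
    ← Fin.prod_univ_eq_prod_range]
  rfl

/-- The shape of a chain has no more rows than its content has nonzero entries. -/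
theorem colLen_le_of_stripSum_ne_zero {A : Type*} [CommRing A] {W : YoungDiagram → YoungDiagram → A}
    (m n : ℕ) : ∀ (c : Fin n → ℕ) (κ : YoungDiagram), (∀ i : Fin n, m ≤ i → c i = 0) →
      stripSum W n c κ ≠ 0 → κ.colLen 0 ≤ m := by
  induction n with
  | zero =>
    intro c κ _ h
    exact (stripSum_triangular 0 c κ h).1.trans (Nat.zero_le _)
  | succ n ih =>
    intro c κ hc h
    rcases Nat.lt_or_ge n m with hm | hm
    · exact (stripSum_triangular _ c κ h).1.trans hm
    · rw [stripSum_succ] at h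
      obtain ⟨ν, hν, h1⟩ := Finset.exists_ne_zero_of_sum_ne_zero h
      have h2 := isHorizontalStrip_iff.1 (mem_stripsBelow.1 hν)
      have h3 : ν = κ := eq_of_le_of_card_eq h2.1 (by rw [h2.2.1, hc _ hm, add_zero])
      rw [← h3]
      exact ih _ ν (fun i hi => hc i.castSucc hi) (left_ne_zero_of_mul h1)

theorem schurPoly_partsVec_eq_sum {η : YoungDiagram} (h : η.card = N) :
    schurPoly (partsVec N η) =
      ∑ τ ∈ youngDiagramsOfCard N, kostkaFoulkes η τ • hallLittlewoodP (partsVec N τ) := by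
  subst h
  simp only [Algebra.smul_def, ← constQ_eq_algebraMap]
  exact (isKostkaFoulkesRow_kostkaFoulkes η).2

theorem kostkaNumber_eq_stripSum {n : ℕ} {c : Fin n → ℕ} (hc : ∑ a, c a = N) {ξ : YoungDiagram}
    (h : ξ.card = N) : kostkaNumber ξ c =
      stripSum (fun _ _ => (1 : ℤ)) N (partsVec N (sortedDiagram c)) ξ := by
  subst h
  exact eval_one_kostkaFoulkes (by rw [card_sortedDiagram, hc])

/-- The Schur expansion of a product of elementary symmetric functions: the coefficients are the
Kostka numbers of the conjugate partitions. -/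
theorem prod_elemSym_eq_sum_kostkaNumber {n : ℕ} {c : Fin n → ℕ} (hc : ∑ a, c a = N) :
    ∏ a, elemSym (varX : Fin N → RatFunField N) (c a) =
      ∑ η ∈ youngDiagramsOfCard N,
        (C (kostkaNumber η.transpose c) : ℤ[X]) • schurPoly (partsVec N η) := by
  have hσ : (sortedDiagram c).card = N := by rw [card_sortedDiagram, hc]
  rw [← prod_elemSym_sortedDiagram _ c hc, prod_elemSym_eq_sum_schurPoly _ (sum_partsVec hσ),
    ← sum_youngDiagrams_transpose]
  refine Finset.sum_congr rfl fun η hη => ?_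
  rw [kostkaNumber_eq_stripSum hc
    (by rw [card_transpose]; exact mem_youngDiagramsOfCard.1 hη), map_stripSum, map_one,
    partsVec_eq_colVec N η]

theorem kostkaNumber_eq_zero {n : ℕ} {c : Fin n → ℕ} (hc : ∑ a, c a = N) {ξ : YoungDiagram}
    (h : ξ.card = N) (hn : n < ξ.colLen 0) : kostkaNumber ξ c = 0 := by
  rw [kostkaNumber_eq_stripSum hc h]
  by_contra h0
  exact absurd (colLen_le_of_stripSum_ne_zero n N _ ξ
    (fun i hi => rowLen_eq_zero ((colLen_sortedDiagram_le c).trans hi)) h0) (not_le.2 hn)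

/-- Both sides are the coefficient of `P_μ` in the expansion of a product of elementary symmetric
functions. -/
theorem sum_kostkaNumber_mul_kostkaFoulkes {n : ℕ} {c : Fin n → ℕ} (hc : ∑ a, c a = N)
    {μ : YoungDiagram} (hμ : μ.card = N) :
    ∑ η ∈ youngDiagramsOfCard N, C (kostkaNumber η.transpose c) * kostkaFoulkes η μ =
      stripSum (stripWeight X) n c μ.transpose := by
  have h1 : ∑ κ ∈ youngDiagramsOfCard N, (∑ η ∈ youngDiagramsOfCard N,
        C (kostkaNumber η.transpose c) * kostkaFoulkes η κ.transpose -
          stripSum (stripWeight X) n c κ) • hallLittlewoodP (colVec N κ) = 0 := by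
    simp only [sub_smul, Finset.sum_sub_distrib, ← prod_elemSym_eq_sum_hallLittlewoodP c hc,
      Finset.sum_smul]
    rw [prod_elemSym_eq_sum_kostkaNumber hc, Finset.sum_comm, sub_eq_zero]
    refine Finset.sum_congr rfl fun η hη => ?_
    rw [schurPoly_partsVec_eq_sum (mem_youngDiagramsOfCard.1 hη), Finset.smul_sum,
      ← sum_youngDiagrams_transpose]
    refine Finset.sum_congr rfl fun τ _ => ?_
    rw [YoungDiagram.transpose_transpose, mul_smul, partsVec_eq_colVec]
  rw [← Finset.sum_attach, ← Finset.univ_eq_attach] at h1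
  have h2 := Fintype.linearIndependent_iff.1 (linearIndependent_hallLittlewoodP (N := N)) _ h1
    ⟨μ.transpose, by rw [mem_youngDiagramsOfCard, card_transpose, hμ]⟩
  simpa only [YoungDiagram.transpose_transpose] using sub_eq_zero.1 h2

end Comparison

end

theorem proposition4p3 (n : ℕ) (μ : YoungDiagram) (lam : Fin n → ℕ)
    (hsize : ∑ a, lam a = μ.card) (hμ : (μ.rowLen 0 : ℤ) ≤ (n : ℤ) - 1) :
    algebraMap ℤ[X] (FractionRing ℤ[X])
        (∑ η ∈ (youngDiagramsOfCard μ.card).filter (fun η => η.rowLen 0 ≤ n),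
          C (kostkaNumber η.transpose lam) * kostkaFoulkes η μ) =
      ∑ ν ∈ stripChains lam μ.transpose,
        ∏ a ∈ Finset.univ.filter (fun a : Fin n => 1 ≤ (a : ℕ)),
          ∏ i ∈ Finset.range (μ.rowLen 0),
            qBinom (((ν a.succ).rowLen i : ℤ) - ((ν a.succ).rowLen (i + 1) : ℤ))
              (((ν a.castSucc).rowLen i : ℤ) - ((ν a.succ).rowLen (i + 1) : ℤ)) := by
  rw [Finset.sum_filter_of_ne, sum_kostkaNumber_mul_kostkaFoulkes hsize rfl,
    algebraMap_stripSum_eq, YoungDiagram.colLen_transpose]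
  intro η hη hne
  by_contra hn
  refine hne ?_
  rw [kostkaNumber_eq_zero hsize (by rw [card_transpose]; exact mem_youngDiagramsOfCard.1 hη)
    (by rw [YoungDiagram.colLen_transpose]; omega), C_0, zero_mul]
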